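/- **Setting.** Let $u:[0,\infty)\times\mathbb R\to\mathbb R$, $(t,x)\mapsto u(x,t)$, be a bounded measurable function such that $u(\cdot,t)$ has locally bounded variation for every $t\ge 0$, $t\mapsto u(\cdot,t)$ is continuous from $[0,\infty)$ to $L^1_{loc}(\mathbb R)$, the initial datum $u_0=u(\cdot,0)$ is $C^\infty$, and $u$ is an entropy solution of the inviscid Burgers equation $u_t+(u^2/2)_x=0$, that is, $$\int_0^\infty\!\!\int_{\mathbb R}\Big(u\,\varphi_t+\tfrac12u^2\varphi_x\Big)\,dx\,dt+\int_{\mathbb R}u_0(x)\varphi(x,0)\,dx=0$$ for all smooth compactly supported $\varphi$ on $\mathbb R\times\mathbb R$, and $u(x-,t)\ge u(x+,t)$ for all $t>0$, $x\in\mathbb R$. Put $\bar u(x,t)=\frac12\big(u(x+,t)+u(x-,t)\big)$, and call $(x,t)$ a shock if $u(x-,t)>u(x+,t)$. A *generalized characteristic* on $[s,T]$ is a continuous curve $x:[s,T]\to\mathbb R$ whose right derivative satisfies $D^+_t x(t)=\bar u(x(t),t)$ for all $t\in[s,T)$. The forward coalescing flow carries $y$ at time $s$ to $z$ at time $T$ if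 there is such a curve with $x(s)=y$, $x(T)=z$. Fix $t_f>0$ and a shock $(x_f,t_f)$. Let $t_*$ be the infimum of the times $t\in(0,t_f]$ at which there is a shock $(y,t)$ that the forward flow carries to $(x_f,t_f)$ (the time when the first of the possibly many shocks that merge into $(x_f,t_f)$ is formed). Fix $t_0\in[0,t_*)$, and let $B$ be the shock interval at time $t_0$: the set of the positions $b$ that the forward flow carries from time $t_0$ to $x_f$ at time $t_f$. A *geometric process* is a real-valued stochastic process $x(t)$, $t\in[0,t_f]$, on some probability space, all of whose paths are generalized characteristics on $[0,t_f]$, such that $x(t_f)=x_f$ almost surely and $x(t_0)$ is uniformly distributed on $B$. Its velocity is $\dot x(t)=\bar u(x(t),t)$. **Proposition 3.2.** In this setting a geometric process exists. For every geometric process, $\dot x(t)$ is an integrable random variable for every $t\in[0,t_f]$, and the velocity is a backward martingale in the sense that $$\mathbb E\big(\dot x(t)\,\big|\,\dot x(s)\big)=\dot x(s)\quad\text{almost surely, for all } t\le s,\ t,s\in[0,t_f].$$ -/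

import Mathlib

open Set Filter Topology MeasureTheory ProbabilityTheory
open scoped ContDiff

noncomputable section

/-- Entropy solutions of the inviscid Burgers equation `u_t + (u ^ 2 / 2)_x = 0` on `[0, ∞) × ℝ`,
in the class of bounded functions of locally bounded variation in space. Here `u t x` is the velocity
at time `t` and position `x`, and the initial datum is `u 0`. Values at negative times play no
role. -/
structure IsEntropySolution (u : ℝ → ℝ → ℝ) : Prop where
  aestronglyMeasurable : AEStronglyMeasurable (fun p : ℝ × ℝ => u p.1 p.2)
    (volume.restrict (Ioi (0 : ℝ) ×ˢ (univ : Set ℝ)))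
  bounded : ∃ M : ℝ, ∀ t, 0 ≤ t → ∀ x, |u t x| ≤ M
  /-- Every time slice is of locally bounded variation; in particular it has one-sided limits. -/
  boundedVariation : ∀ t, 0 ≤ t → LocallyBoundedVariationOn (u t) univ
  /-- The map `t ↦ u t` is continuous from `[0, ∞)` to `L¹_loc(ℝ)`. -/
  continuous_L1loc : ∀ t, 0 ≤ t → ∀ R : ℝ,
    Tendsto (fun s => ∫ x in Icc (-R) R, |u s x - u t x|) (𝓝[Ici 0] t) (𝓝 0)
  /-- The equation and the initial condition in the sense of distributions. -/
  weak : ∀ φ : ℝ × ℝ → ℝ, ContDiff ℝ ∞ φ → HasCompactSupport φ →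
    (∫ p in Ioi (0 : ℝ) ×ˢ (univ : Set ℝ),
        (u p.1 p.2 * fderiv ℝ φ p (1, 0) + u p.1 p.2 ^ 2 / 2 * fderiv ℝ φ p (0, 1)))
      + ∫ x, u 0 x * φ (0, x) = 0
  /-- The Lax admissibility condition: `u(x-, t) ≥ u(x+, t)`. -/
  lax : ∀ t, 0 < t → ∀ x, Function.rightLim (u t) x ≤ Function.leftLim (u t) x

/-- The averaged velocity `ū(x, t) = (u(x+, t) + u(x-, t)) / 2`. -/
def ubar (u : ℝ → ℝ → ℝ) (t x : ℝ) : ℝ :=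
  (Function.rightLim (u t) x + Function.leftLim (u t) x) / 2

/-- The point `x` carries a shock at time `t`: `u(x-, t) > u(x+, t)`. -/
def IsShock (u : ℝ → ℝ → ℝ) (t x : ℝ) : Prop :=
  Function.rightLim (u t) x < Function.leftLim (u t) x

/-- Generalized characteristics on `[s, T]`: continuous curves with right derivative
`D⁺ X(t) = ū(X(t), t)` for all `t` in `[s, T)`. -/
structure IsGenChar (u : ℝ → ℝ → ℝ) (s T : ℝ) (X : ℝ → ℝ) : Prop where
  continuousOn : ContinuousOn X (Icc s T)
  rightDeriv : ∀ t ∈ Ico s T, HasDerivWithinAt X (ubar u t (X t)) (Ioi t) t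

/-- The forward coalescing flow carries the position `y` at time `s` to the position `x` at
time `T`. -/
def FlowsTo (u : ℝ → ℝ → ℝ) (s y T x : ℝ) : Prop :=
  ∃ X : ℝ → ℝ, IsGenChar u s T X ∧ X s = y ∧ X T = x

/-- The shock interval: positions at time `s` which the forward coalescing flow carries to the
position `xf` at time `tf`. -/
def shockInterval (u : ℝ → ℝ → ℝ) (tf xf s : ℝ) : Set ℝ :=
  {b | FlowsTo u s b tf xf}

/-- The time at which the first shock forms among all the shocks that have merged into the one
located at `xf` at time `tf`. -/
def formationTime (u : ℝ → ℝ → ℝ) (tf xf : ℝ) : ℝ :=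
  sInf {t | t ∈ Ioc 0 tf ∧ ∃ y, IsShock u t y ∧ FlowsTo u t y tf xf}

/-- The geometric backward process ending at the shock `xf` at time `tf`: a random generalized
characteristic on `[0, tf]` with `X(tf) = xf` almost surely, whose position at time `t₀` is uniformly
distributed over the shock interval at time `t₀`. -/
structure IsGeometricProcess {Ω : Type*} [MeasurableSpace Ω] (u : ℝ → ℝ → ℝ) (tf xf t₀ : ℝ)
    (P : Measure Ω) (X : ℝ → Ω → ℝ) : Prop where
  measurable : ∀ t ∈ Icc 0 tf, Measurable (X t)
  isGenChar : ∀ w, IsGenChar u 0 tf (fun t => X t w)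
  final : ∀ᵐ w ∂P, X tf w = xf
  uniform : pdf.IsUniform (X t₀) (shockInterval u tf xf t₀) P volume

/-- The velocity process `ẋ(t) = D⁺ x(t) = ū(x(t), t)`. -/
def velocity {Ω : Type*} (u : ℝ → ℝ → ℝ) (X : ℝ → Ω → ℝ) (t : ℝ) (w : Ω) : ℝ :=
  ubar u t (X t w)

end

/-!
The velocity is the space derivative of a Lipschitz potential `U` which satisfies the
Hamilton-Jacobi equation `U_t + U_x ^ 2 / 2 = 0`; the tool is the Hopf-Lax formula

`U t x = min_y (U s y + (x - y) ^ 2 / (2 * (t - s)))`.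

The potential comes from the weak formulation: tested with products of a function of time and a
function of space, it says that `∫_0^x u t - ∫_0^x u 0 + ∫_0^t u ^ 2 / 2` is constant in `x`
(`IsEntropySolution.exists_isPotential`). The Hopf-Lax formula is proved by comparison. Let `A` be
the mean of `U` over `[x, x + ε]`; then `A_t + A_x ^ 2 / 2` is minus half the variance of the
velocity over `[x, x + ε]`. If `φ` is an explicit solution of the Hamilton-Jacobi equation, then by
the envelope theorem the minimum over `x` of `A - φ` has this as its time derivative, and the
minimum of `φ - A` has the opposite one. As the variance is nonnegative, the second minimum is
nondecreasing, which is the upper bound (`hopfLax_le`) and does not need the Lax condition. As `ε`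
tends to `0`, the minimum points of `A - φ` accumulate at minimum points of `U - φ`; the Lax
condition forbids a jump there, so the variance tends to `0`, and the minimum of `U - φ` is constant
in time, which is the lower bound (`exists_hopfLax_eq`).

The minimizers in the Hopf-Lax formula are the feet of the backward characteristics. These do not
meet (`foot_lt_foot`), carry a constant velocity (`leftLim_eq_of_isFoot`), and the extreme ones
issue from `(x, t)` with the slopes `u(x-, t)` and `u(x+, t)` (`isFoot_leftLim`, `isFoot_rightLim`).
Hence every position `b` at time `s` lies between the extreme feet of exactly one position at time
`t`. This is a flow (`Reaches`), its curves satisfy the Rankine-Hugoniot condition and so are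
generalized characteristics, and by Oleinik's estimate there are no others (`flowsTo_iff_reaches`).

For the martingale property, the Hopf-Lax formula at the two extreme feet of a shock says that the
mean of the velocity at time `t₀` over the interval between them is the velocity `ū` of the shock
(`setIntegral_ubar_sub`). Since the position at time `t₀` is uniformly distributed, the velocities
at times `t₀` and `t ≥ t₀` have the same mean over each fibre of the position at time `t` over a
shock; there are countably many shocks, and elsewhere the two velocities agree. For `t ≤ t₀` they
agree almost surely, as no shock on the way to the final one has formed by time `t₀`. So the
velocities at `t₀` and at `t` have the same integral over every event that is determined by the
position at time `t` (`setIntegral_velocity_eq`). An event given by the velocity at time `s ≥ t` is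
determined by the position at time `s`, hence also by the one at time `t`, and comparing both with
`t₀` gives the claim.
-/

/-! ### Potentials of a velocity field -/

/-- A velocity field with bounded, regulated slices satisfying the Lax condition, together with a
potential `U` of it: `U_x = u`, and `U_t = -u ^ 2 / 2` holds after averaging in space. The averaging
avoids any regularity of `u` in time beyond the continuity of the averages of `u ^ 2`. Here `M` is a
bound of the velocity, and so a Lipschitz constant of `U` in space. -/
structure IsPotential (u U : ℝ → ℝ → ℝ) (M : ℝ) : Prop where
  nonneg : 0 ≤ M
  bound : ∀ t, 0 ≤ t → ∀ x, |u t x| ≤ M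
  meas : ∀ t, 0 ≤ t → Measurable (u t)
  tendsto_left : ∀ t, 0 ≤ t → ∀ x, Tendsto (u t) (𝓝[<] x) (𝓝 (Function.leftLim (u t) x))
  tendsto_right : ∀ t, 0 ≤ t → ∀ x, Tendsto (u t) (𝓝[>] x) (𝓝 (Function.rightLim (u t) x))
  lax : ∀ t, 0 ≤ t → ∀ x, Function.rightLim (u t) x ≤ Function.leftLim (u t) x
  integral_eq : ∀ t, 0 ≤ t → ∀ x y, ∫ z in x..y, u t z = U t y - U t x
  continuousOn_sq : ∀ a b : ℝ, ContinuousOn (fun t => ∫ x in a..b, u t x ^ 2) (Ici 0)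
  balance : ∀ t, 0 ≤ t → ∀ a b, ∫ x in a..b, U t x =
    (∫ x in a..b, U 0 x) - 1 / 2 * ∫ τ in (0 : ℝ)..t, ∫ x in a..b, u τ x ^ 2

namespace IsPotential

variable {u U : ℝ → ℝ → ℝ} {M : ℝ}

theorem intervalIntegrable (h : IsPotential u U M) {t : ℝ} (ht : 0 ≤ t) (a b : ℝ) :
    IntervalIntegrable (u t) volume a b := by
  refine (intervalIntegrable_const (c := M)).mono_fun (h.meas t ht).aestronglyMeasurable ?_
  filter_upwards with x
  rw [Real.norm_eq_abs, Real.norm_eq_abs, abs_of_nonneg h.nonneg]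
  exact h.bound t ht x

theorem intervalIntegrable_sq (h : IsPotential u U M) {t : ℝ} (ht : 0 ≤ t) (a b : ℝ) :
    IntervalIntegrable (fun x => u t x ^ 2) volume a b := by
  refine (intervalIntegrable_const (c := M ^ 2)).mono_fun
    ((h.meas t ht).pow_const 2).aestronglyMeasurable ?_
  filter_upwards with x
  rw [Real.norm_eq_abs, Real.norm_eq_abs, abs_of_nonneg (sq_nonneg _), abs_of_nonneg (sq_nonneg _)]
  exact sq_le_sq.2 (by rw [abs_of_nonneg h.nonneg]; exact h.bound t ht x)

theorem abs_sub_le (h : IsPotential u U M) {t : ℝ} (ht : 0 ≤ t) (x y : ℝ) :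
    |U t y - U t x| ≤ M * |y - x| := by
  rw [← h.integral_eq t ht]
  exact intervalIntegral.norm_integral_le_of_norm_le_const (f := u t) fun z _ => h.bound t ht z

theorem continuous (h : IsPotential u U M) {t : ℝ} (ht : 0 ≤ t) : Continuous (U t) := by
  have : LipschitzWith ⟨M, h.nonneg⟩ (U t) := LipschitzWith.of_dist_le_mul fun x y => by
    rw [Real.dist_eq, Real.dist_eq]
    exact h.abs_sub_le ht y x
  exact this.continuous

theorem hasDerivWithinAt_right (h : IsPotential u U M) {t : ℝ} (ht : 0 ≤ t) (x : ℝ) :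
    HasDerivWithinAt (U t) (Function.rightLim (u t) x) (Ici x) x := by
  have h1 := intervalIntegral.integral_hasDerivWithinAt_of_tendsto_ae_right (s := Ici x)
    (t := Ioi x) (h.intervalIntegrable ht x x)
    ((h.meas t ht).stronglyMeasurable.stronglyMeasurableAtFilter)
    ((h.tendsto_right t ht x).mono_left inf_le_left)
  refine (h1.add_const (U t x)).congr (fun y _ => ?_) ?_ <;> simp [h.integral_eq t ht]

theorem hasDerivWithinAt_left (h : IsPotential u U M) {t : ℝ} (ht : 0 ≤ t) (x : ℝ) :
    HasDerivWithinAt (U t) (Function.leftLim (u t) x) (Iic x) x := by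
  have h1 := intervalIntegral.integral_hasDerivWithinAt_of_tendsto_ae_right (s := Iic x)
    (t := Iic x) (c := Function.leftLim (u t) x) (h.intervalIntegrable ht x x)
    ((h.meas t ht).stronglyMeasurable.stronglyMeasurableAtFilter) ?_
  · refine (h1.add_const (U t x)).congr (fun y _ => ?_) ?_ <;> simp [h.integral_eq t ht]
  · have h2 : 𝓝[≤] x ⊓ ae volume ≤ 𝓝[<] x := by
      have : {x}ᶜ ∈ ae (volume : Measure ℝ) := by simp [mem_ae_iff]
      calc 𝓝[≤] x ⊓ ae volume ≤ 𝓝[≤] x ⊓ 𝓟 {x}ᶜ := inf_le_inf_left _ (le_principal_iff.2 this)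
        _ = 𝓝[<] x := by
          rw [nhdsWithin, inf_assoc, inf_principal, nhdsWithin]
          congr 2
          ext y; simp [lt_iff_le_and_ne]
    exact (h.tendsto_left t ht x).mono_left h2

end IsPotential

/-! ### Space averages of the potential -/

/-- The envelope theorem: the time derivative of a minimum value is the partial derivative in time
at the minimum point, however irregular the minimum point `ξ t` is as a function of time. -/
theorem integral_deriv_argmin {F : ℝ → ℝ → ℝ} {F' ξ : ℝ → ℝ} {a b L : ℝ} (hab : a ≤ b)
    (hmin : ∀ t ∈ Icc a b, ∀ x, F t (ξ t) ≤ F t x)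
    (hlip : ∀ r ∈ Icc a b, ∀ s ∈ Icc a b, ∀ t ∈ Icc a b,
      |F t (ξ r) - F s (ξ r)| ≤ L * |t - s|)
    (hderiv : ∀ t ∈ Ioo a b, HasDerivAt (fun s => F s (ξ t)) (F' t) t) :
    IntervalIntegrable F' volume a b ∧ ∫ t in a..b, F' t = F b (ξ b) - F a (ξ a) := by
  have hL : LipschitzOnWith L.toNNReal (fun t => F t (ξ t)) (uIcc a b) := by
    rw [uIcc_of_le hab]
    have key : ∀ s ∈ Icc a b, ∀ t ∈ Icc a b, F t (ξ t) - F s (ξ s) ≤ L * |t - s| := by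
      intro s hs t ht
      have h1 := hmin t ht (ξ s)
      have h2 := (le_abs_self _).trans (hlip s hs s hs t ht)
      linarith
    refine LipschitzOnWith.of_dist_le_mul fun t ht s hs => ?_
    rw [Real.dist_eq, Real.dist_eq]
    refine (abs_le.2 ⟨?_, ?_⟩ : |F t (ξ t) - F s (ξ s)| ≤ L * |t - s|).trans
      (mul_le_mul_of_nonneg_right (Real.le_coe_toNNReal L) (abs_nonneg _))
    · have := key t ht s hs
      rw [abs_sub_comm] at this
      linarith
    · exact key s hs t ht
  have hac := hL.absolutelyContinuousOnInterval
  have hae : ∀ᵐ t, t ∈ uIoc a b → deriv (fun t => F t (ξ t)) t = F' t := by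
    have hne : ∀ᵐ t : ℝ, t ≠ b := by simp [ae_iff]
    filter_upwards [hac.ae_differentiableAt, hne] with t ht htb hmem
    rw [uIoc_of_le hab] at hmem
    have hIoo : t ∈ Ioo a b := ⟨hmem.1, lt_of_le_of_ne hmem.2 htb⟩
    have hd := (ht (uIoc_subset_uIcc (by rwa [uIoc_of_le hab]))).hasDerivAt
    -- `s ↦ F s (ξ t) - F s (ξ s)` has a minimum at `s = t`
    have hloc : IsLocalMin (fun s => F s (ξ t) - F s (ξ s)) t := by
      filter_upwards [isOpen_Ioo.mem_nhds hIoo] with s hs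
      have := hmin s (Ioo_subset_Icc_self hs) (ξ t)
      simp only [sub_self]
      linarith
    have := hloc.hasDerivAt_eq_zero ((hderiv t hIoo).sub hd)
    linarith
  have hae' : deriv (fun t => F t (ξ t)) =ᵐ[volume.restrict (uIoc a b)] F' :=
    (ae_restrict_iff' measurableSet_uIoc).2 hae
  refine ⟨hac.intervalIntegrable_deriv.congr_ae hae', ?_⟩
  rw [← hac.integral_deriv_eq_sub]
  exact (intervalIntegral.integral_congr_ae hae).symm

theorem exists_forall_add_sq_div_le {g : ℝ → ℝ} {M : ℝ} (hM : 0 ≤ M)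
    (hg : ∀ x y, |g x - g y| ≤ M * |x - y|) (X : ℝ) {k : ℝ} (hk : 0 < k) :
    ∃ ξ, ∀ x, g ξ + (ξ - X) ^ 2 / (2 * k) ≤ g x + (x - X) ^ 2 / (2 * k) := by
  have hc : Continuous g := by
    have : LipschitzWith ⟨M, hM⟩ g := LipschitzWith.of_dist_le_mul fun x y => by
      rw [Real.dist_eq, Real.dist_eq]; exact hg x y
    exact this.continuous
  have hR : 0 ≤ 2 * M * k := by positivity
  obtain ⟨ξ, hξ, hmin⟩ := (isCompact_Icc (a := X - 2 * M * k) (b := X + 2 * M * k)).exists_isMinOn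
    ⟨X, by constructor <;> linarith⟩
    (f := fun x => g x + (x - X) ^ 2 / (2 * k)) (by fun_prop)
  refine ⟨ξ, fun x => ?_⟩
  by_cases hx : x ∈ Icc (X - 2 * M * k) (X + 2 * M * k)
  · exact hmin hx
  · have h1 : g ξ + (ξ - X) ^ 2 / (2 * k) ≤ g X + (X - X) ^ 2 / (2 * k) :=
      hmin (⟨by linarith, by linarith⟩ : X ∈ Icc (X - 2 * M * k) (X + 2 * M * k))
    have h2 : 2 * M * k ≤ |x - X| := by
      by_contra hcon
      rw [not_le, abs_lt] at hcon
      exact hx ⟨by linarith, by linarith⟩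
    have h3 := (abs_le.1 (hg x X)).1
    have h4 : M * |x - X| ≤ (x - X) ^ 2 / (2 * k) := by
      rw [le_div_iff₀ (by positivity), ← sq_abs (x - X)]
      nlinarith [abs_nonneg (x - X)]
    simp only [sub_self] at h1
    norm_num at h1
    linarith

theorem abs_sub_le_of_forall_add_sq_div_le {g : ℝ → ℝ} {M : ℝ}
    (hg : ∀ x y, |g x - g y| ≤ M * |x - y|) {X k ξ : ℝ} (hk : 0 < k)
    (hξ : ∀ x, g ξ + (ξ - X) ^ 2 / (2 * k) ≤ g x + (x - X) ^ 2 / (2 * k)) :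
    |ξ - X| ≤ 2 * M * k := by
  have h1 := hξ X
  have h3 := (abs_le.1 (hg ξ X)).1
  simp only [sub_self] at h1
  norm_num at h1
  have h4 : (ξ - X) ^ 2 / (2 * k) ≤ M * |ξ - X| := by linarith
  rw [div_le_iff₀ (by positivity), ← sq_abs] at h4
  rcases (abs_nonneg (ξ - X)).eq_or_lt with h | h
  · have := hg 0 1
    have hM : 0 ≤ M := by
      have := (abs_nonneg _).trans this
      norm_num at this
      exact this
    rw [← h]; positivity
  · nlinarith

/-- The mean of the potential over `[x, x + ε]`. -/
noncomputable def meanPotential (U : ℝ → ℝ → ℝ) (ε t x : ℝ) : ℝ := ε⁻¹ * ∫ z in x..x + ε, U t z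

/-- The variance of the velocity `u t`, with potential `U t`, over `[x, x + ε]`. -/
noncomputable def velocityVar (u U : ℝ → ℝ → ℝ) (ε t x : ℝ) : ℝ :=
  ε⁻¹ * (∫ z in x..x + ε, u t z ^ 2) - (ε⁻¹ * (U t (x + ε) - U t x)) ^ 2

namespace IsPotential

variable {u U : ℝ → ℝ → ℝ} {M : ℝ}

theorem abs_meanPotential_sub_le (h : IsPotential u U M) {t ε : ℝ} (ht : 0 ≤ t) (hε : 0 < ε)
    (x : ℝ) : |meanPotential U ε t x - U t x| ≤ M * ε := by
  have h1 : meanPotential U ε t x - U t x = ε⁻¹ * ∫ z in x..x + ε, (U t z - U t x) := by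
    rw [intervalIntegral.integral_sub ((h.continuous ht).intervalIntegrable _ _) (by simp)]
    simp [meanPotential]
    field_simp
  have h2 : |∫ z in x..x + ε, (U t z - U t x)| ≤ (M * ε) * |x + ε - x| := by
    refine intervalIntegral.norm_integral_le_of_norm_le_const
      (f := fun z => U t z - U t x) fun z hz => ?_
    rw [uIoc_of_le (by linarith)] at hz
    refine (h.abs_sub_le ht x z).trans (mul_le_mul_of_nonneg_left ?_ h.nonneg)
    rw [abs_of_pos (by linarith [hz.1])]
    linarith [hz.2]
  rw [h1, abs_mul, abs_of_pos (inv_pos.2 hε)]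
  rw [add_sub_cancel_left, abs_of_pos hε] at h2
  calc ε⁻¹ * |∫ z in x..x + ε, (U t z - U t x)| ≤ ε⁻¹ * (M * ε * ε) := by gcongr
    _ = M * ε := by field_simp

theorem abs_meanPotential_sub_space_le (h : IsPotential u U M) {t ε : ℝ} (ht : 0 ≤ t)
    (hε : 0 < ε) (x y : ℝ) :
    |meanPotential U ε t x - meanPotential U ε t y| ≤ M * |x - y| := by
  have hc := h.continuous ht
  have h1 : meanPotential U ε t x - meanPotential U ε t y
      = ε⁻¹ * ∫ z in (0 : ℝ)..ε, (U t (x + z) - U t (y + z)) := by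
    rw [intervalIntegral.integral_sub (Continuous.intervalIntegrable (by fun_prop) _ _)
      (Continuous.intervalIntegrable (by fun_prop) _ _)]
    simp [meanPotential, intervalIntegral.integral_comp_add_left (fun z => U t z)]
    ring
  have h2 : |∫ z in (0 : ℝ)..ε, (U t (x + z) - U t (y + z))| ≤ (M * |x - y|) * |ε - 0| := by
    refine intervalIntegral.norm_integral_le_of_norm_le_const
      (f := fun z => U t (x + z) - U t (y + z)) fun z hz => ?_
    have := h.abs_sub_le ht (y + z) (x + z)
    rwa [add_sub_add_right_eq_sub] at this
  rw [h1, abs_mul, abs_of_pos (inv_pos.2 hε)]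
  rw [sub_zero, abs_of_pos hε] at h2
  calc ε⁻¹ * _ ≤ ε⁻¹ * (M * |x - y| * ε) := by gcongr
    _ = M * |x - y| := by field_simp

theorem hasDerivAt_meanPotential_space (h : IsPotential u U M) {t : ℝ} (ht : 0 ≤ t) (ε x : ℝ) :
    HasDerivAt (meanPotential U ε t) (ε⁻¹ * (U t (x + ε) - U t x)) x := by
  have hc := h.continuous ht
  have h1 : HasDerivAt (fun y => ∫ z in (0 : ℝ)..y, U t z) (U t x) x :=
    intervalIntegral.integral_hasDerivAt_right (hc.intervalIntegrable _ _)
      hc.stronglyMeasurable.stronglyMeasurableAtFilter hc.continuousAt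
  have h2 : HasDerivAt (fun y => ∫ z in (0 : ℝ)..y + ε, U t z) (U t (x + ε)) x := by
    have h3 : HasDerivAt (fun y => ∫ z in (0 : ℝ)..y, U t z) (U t (x + ε)) (x + ε) :=
      intervalIntegral.integral_hasDerivAt_right (hc.intervalIntegrable _ _)
        hc.stronglyMeasurable.stronglyMeasurableAtFilter hc.continuousAt
    exact h3.comp_add_const x ε
  refine ((h2.sub h1).const_mul ε⁻¹).congr_of_eventuallyEq (Eventually.of_forall fun y => ?_)
  simp only [meanPotential, Pi.sub_apply]
  rw [intervalIntegral.integral_interval_sub_left (hc.intervalIntegrable _ _)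
    (hc.intervalIntegrable _ _)]

theorem integral_sq_le (h : IsPotential u U M) {t : ℝ} (ht : 0 ≤ t) (a b : ℝ) :
    |∫ x in a..b, u t x ^ 2| ≤ M ^ 2 * |b - a| := by
  refine intervalIntegral.norm_integral_le_of_norm_le_const (f := fun x => u t x ^ 2)
    fun z _ => ?_
  rw [Real.norm_eq_abs, abs_of_nonneg (sq_nonneg _)]
  exact sq_le_sq.2 (by rw [abs_of_nonneg h.nonneg]; exact h.bound t ht z)

theorem hasDerivAt_meanPotential_time (h : IsPotential u U M) {t : ℝ} (ht : 0 < t) (ε x : ℝ) :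
    HasDerivAt (fun s => meanPotential U ε s x)
      (-(1 / 2) * (ε⁻¹ * ∫ z in x..x + ε, u t z ^ 2)) t := by
  have hc := h.continuousOn_sq x (x + ε)
  have h1 : HasDerivAt (fun s => ∫ τ in (0 : ℝ)..s, ∫ z in x..x + ε, u τ z ^ 2)
      (∫ z in x..x + ε, u t z ^ 2) t := by
    refine intervalIntegral.integral_hasDerivAt_right ?_ ?_ (hc.continuousAt (Ici_mem_nhds ht))
    · exact (hc.mono (by rw [uIcc_of_le ht.le]; exact fun s hs => hs.1)).intervalIntegrable
    · exact (hc.mono Ioi_subset_Ici_self).stronglyMeasurableAtFilter isOpen_Ioi t ht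
  have h2 := (((h1.const_mul (1 / 2)).const_sub (∫ z in x..x + ε, U 0 z)).const_mul ε⁻¹)
  refine (h2.congr_of_eventuallyEq ?_).congr_deriv (by ring)
  filter_upwards [Ioi_mem_nhds ht] with s hs
  rw [meanPotential, h.balance s (le_of_lt hs)]

theorem abs_meanPotential_sub_time_le (h : IsPotential u U M) {s t ε : ℝ} (hs : 0 ≤ s)
    (ht : 0 ≤ t) (hε : 0 < ε) (x : ℝ) :
    |meanPotential U ε t x - meanPotential U ε s x| ≤ M ^ 2 / 2 * |t - s| := by
  have hc := h.continuousOn_sq x (x + ε)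
  have hi : ∀ r, 0 ≤ r → IntervalIntegrable (fun τ => ∫ z in x..x + ε, u τ z ^ 2) volume 0 r :=
    fun r hr => (hc.mono (by rw [uIcc_of_le hr]; exact fun s hs => hs.1)).intervalIntegrable
  have h1 : meanPotential U ε t x - meanPotential U ε s x =
      -(1 / 2) * (ε⁻¹ * ∫ τ in s..t, ∫ z in x..x + ε, u τ z ^ 2) := by
    rw [meanPotential, meanPotential, h.balance s hs, h.balance t ht,
      ← intervalIntegral.integral_interval_sub_left (hi t ht) (hi s hs)]
    ring
  have h2 : |∫ τ in s..t, ∫ z in x..x + ε, u τ z ^ 2| ≤ (M ^ 2 * ε) * |t - s| := by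
    refine intervalIntegral.norm_integral_le_of_norm_le_const
      (f := fun τ => ∫ z in x..x + ε, u τ z ^ 2) fun τ hτ => ?_
    have hτ0 : 0 ≤ τ := by
      rw [uIoc, mem_Ioc] at hτ
      exact (le_min hs ht).trans hτ.1.le
    have := h.integral_sq_le hτ0 x (x + ε)
    rwa [add_sub_cancel_left, abs_of_pos hε] at this
  rw [h1, abs_mul, abs_mul, abs_of_pos (inv_pos.2 hε)]
  calc _ ≤ |(-(1 / 2) : ℝ)| * (ε⁻¹ * (M ^ 2 * ε * |t - s|)) := by gcongr
    _ = M ^ 2 / 2 * |t - s| := by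
      rw [abs_neg, abs_of_pos (by norm_num)]; field_simp

theorem abs_sub_time_le (h : IsPotential u U M) {s t : ℝ} (hs : 0 ≤ s) (ht : 0 ≤ t) (x : ℝ) :
    |U t x - U s x| ≤ M ^ 2 / 2 * |t - s| := by
  have key : ∀ ε > 0, |U t x - U s x| ≤ M ^ 2 / 2 * |t - s| + ε := by
    intro ε hε
    set δ := ε / (2 * (M + 1)) with hδ
    have hM := h.nonneg
    have hδ0 : 0 < δ := by positivity
    have h1 := abs_le.1 (h.abs_meanPotential_sub_le hs hδ0 x)
    have h2 := abs_le.1 (h.abs_meanPotential_sub_le ht hδ0 x)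
    have h3 := abs_le.1 (h.abs_meanPotential_sub_time_le hs ht hδ0 x)
    have h4 : 2 * (M * δ) ≤ ε := by
      rw [hδ]
      have : 2 * (M * (ε / (2 * (M + 1)))) = M / (M + 1) * ε := by field_simp
      rw [this]
      have : M / (M + 1) ≤ 1 := by rw [div_le_one (by positivity)]; linarith
      nlinarith
    rw [abs_le]
    constructor <;> linarith [h1.1, h1.2, h2.1, h2.2, h3.1, h3.2]
  exact le_of_forall_pos_le_add key

/-- Decomposition of the mean square deviation from a constant. -/
theorem velocityVar_add_sq (h : IsPotential u U M) {t ε : ℝ} (ht : 0 ≤ t) (hε : 0 < ε) (x p : ℝ) :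
    velocityVar u U ε t x + (ε⁻¹ * (U t (x + ε) - U t x) - p) ^ 2 =
      ε⁻¹ * ∫ z in x..x + ε, (u t z - p) ^ 2 := by
  have h1 : ∫ z in x..x + ε, (u t z - p) ^ 2 =
      (∫ z in x..x + ε, u t z ^ 2) - 2 * p * (U t (x + ε) - U t x) + p ^ 2 * ε := by
    rw [← h.integral_eq t ht, ← intervalIntegral.integral_const_mul,
      ← intervalIntegral.integral_sub (h.intervalIntegrable_sq ht _ _)
        ((h.intervalIntegrable ht _ _).const_mul _)]
    have h2 : p ^ 2 * ε = ∫ z in x..x + ε, p ^ 2 := by simp; ring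
    rw [h2, ← intervalIntegral.integral_add ((h.intervalIntegrable_sq ht _ _).sub
        ((h.intervalIntegrable ht _ _).const_mul _)) (by simp)]
    congr 1
    ext z
    ring
  rw [h1, velocityVar]
  field_simp
  ring

theorem velocityVar_nonneg (h : IsPotential u U M) {t ε : ℝ} (ht : 0 ≤ t) (hε : 0 < ε) (x : ℝ) :
    0 ≤ velocityVar u U ε t x := by
  have h1 := h.velocityVar_add_sq ht hε x (ε⁻¹ * (U t (x + ε) - U t x))
  rw [sub_self, zero_pow two_ne_zero, add_zero] at h1
  rw [h1]
  exact mul_nonneg (inv_pos.2 hε).le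
    (intervalIntegral.integral_nonneg (by linarith) fun z _ => sq_nonneg _)

theorem velocityVar_le (h : IsPotential u U M) {t ε : ℝ} (ht : 0 ≤ t) (hε : 0 < ε) (x p C : ℝ)
    (hC : ∀ᵐ z, z ∈ Ioc x (x + ε) → |u t z - p| ≤ C) : velocityVar u U ε t x ≤ C ^ 2 := by
  have h1 := h.velocityVar_add_sq ht hε x p
  have h2 : ‖∫ z in x..x + ε, (u t z - p) ^ 2‖ ≤ C ^ 2 * |x + ε - x| := by
    refine intervalIntegral.norm_integral_le_of_norm_le_const_ae ?_
    rw [uIoc_of_le (by linarith)]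
    filter_upwards [hC] with z hz hz'
    rw [Real.norm_eq_abs, abs_of_nonneg (sq_nonneg _)]
    exact sq_le_sq.2 ((hz hz').trans (le_abs_self _))
  have h3 := (le_abs_self _).trans h2
  rw [add_sub_cancel_left, abs_of_pos hε] at h3
  have h4 : ε⁻¹ * ∫ z in x..x + ε, (u t z - p) ^ 2 ≤ C ^ 2 := by
    calc _ ≤ ε⁻¹ * (C ^ 2 * ε) := by gcongr
      _ = C ^ 2 := by field_simp
  nlinarith [sq_nonneg (ε⁻¹ * (U t (x + ε) - U t x) - p)]

/-- At a point without a jump, the velocity has a limit, so its variance over intervals which shrink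
to that point tends to `0`. -/
theorem tendsto_velocityVar (h : IsPotential u U M) {t x : ℝ} (ht : 0 ≤ t)
    (hx : Function.leftLim (u t) x = Function.rightLim (u t) x) {ξ ε : ℕ → ℝ}
    (hξ : Tendsto ξ atTop (𝓝 x)) (hε : Tendsto ε atTop (𝓝 0)) (hpos : ∀ n, 0 < ε n) :
    Tendsto (fun n => velocityVar u U (ε n) t (ξ n)) atTop (𝓝 0) := by
  have hlim : Tendsto (u t) (𝓝[≠] x) (𝓝 (Function.rightLim (u t) x)) := by
    rw [← Iio_union_Ioi, nhdsWithin_union]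
    exact (hx ▸ h.tendsto_left t ht x).sup (h.tendsto_right t ht x)
  rw [Metric.tendsto_atTop]
  intro δ hδ
  set C := Real.sqrt (δ / 2) with hCdef
  have hC : 0 < C := Real.sqrt_pos.2 (by linarith)
  have hC2 : C ^ 2 = δ / 2 := Real.sq_sqrt (by linarith)
  have h1 : ∀ᶠ z in 𝓝[≠] x, |u t z - Function.rightLim (u t) x| ≤ C := by
    filter_upwards [Metric.tendsto_nhds.1 hlim C hC] with z hz
    rw [Real.dist_eq] at hz
    exact hz.le
  rw [eventually_nhdsWithin_iff, Metric.eventually_nhds_iff] at h1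
  obtain ⟨r, hr, h1⟩ := h1
  obtain ⟨N₁, hN₁⟩ := Metric.tendsto_atTop.1 hξ (r / 2) (by linarith)
  obtain ⟨N₂, hN₂⟩ := Metric.tendsto_atTop.1 hε (r / 2) (by linarith)
  refine ⟨max N₁ N₂, fun n hn => ?_⟩
  have hn1 := hN₁ n ((le_max_left _ _).trans hn)
  have hn2 := hN₂ n ((le_max_right _ _).trans hn)
  rw [Real.dist_eq, abs_lt] at hn1
  rw [Real.dist_eq, sub_zero, abs_of_pos (hpos n)] at hn2
  have hle := h.velocityVar_le ht (hpos n) (ξ n) (Function.rightLim (u t) x) C ?_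
  · rw [Real.dist_eq, sub_zero, abs_of_nonneg (h.velocityVar_nonneg ht (hpos n) _)]
    linarith
  · have hne : ∀ᵐ z : ℝ, z ≠ x := by simp [ae_iff]
    filter_upwards [hne] with z hz hmem
    refine h1 ?_ hz
    rw [Real.dist_eq, abs_lt]
    constructor <;> linarith [hmem.1, hmem.2]

end IsPotential

/-! ### The Hopf-Lax formula -/

theorem deriv_add_div_eq_zero {g : ℝ → ℝ} {g' X k ξ : ℝ} (hd : HasDerivAt g g' ξ)
    (hξ : ∀ x, g ξ + (ξ - X) ^ 2 / (2 * k) ≤ g x + (x - X) ^ 2 / (2 * k)) :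
    g' + (ξ - X) / k = 0 := by
  have h1 : HasDerivAt (fun x => g x + (x - X) ^ 2 / (2 * k)) (g' + (ξ - X) / k) ξ := by
    refine (hd.add ((((hasDerivAt_id ξ).sub_const X).pow 2).div_const (2 * k))).congr_deriv ?_
    simp only [id]
    norm_num
    ring
  exact IsLocalMin.hasDerivAt_eq_zero (Eventually.of_forall hξ) h1

theorem abs_div_sub_div_le {c C δ p q : ℝ} (hc : 0 ≤ c) (hcC : c ≤ C) (hδ : 0 < δ) (hp : δ ≤ p)
    (hq : δ ≤ q) : |c / (2 * p) - c / (2 * q)| ≤ C / (2 * δ ^ 2) * |p - q| := by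
  have hp0 : 0 < p := hδ.trans_le hp
  have hq0 : 0 < q := hδ.trans_le hq
  have h1 : c / (2 * p) - c / (2 * q) = c / (2 * (p * q)) * (q - p) := by field_simp
  rw [h1, abs_mul, abs_of_nonneg (by positivity), abs_sub_comm q p]
  have h2 : δ ^ 2 ≤ p * q := by nlinarith
  have hC : 0 ≤ C := hc.trans hcC
  gcongr

namespace IsPotential

variable {u U : ℝ → ℝ → ℝ} {M : ℝ}

/-- The upper bound in the Hopf-Lax formula. It rests on the nonnegativity of the variance and does
not need the Lax condition. -/
theorem hopfLax_le (h : IsPotential u U M) {s t : ℝ} (hs : 0 ≤ s) (hst : s < t) (x y : ℝ) :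
    U t x ≤ U s y + (x - y) ^ 2 / (2 * (t - s)) := by
  have hM := h.nonneg
  -- comparison with the solution `U s y + (z - y) ^ 2 / (2 * (τ - s))` on `[s + δ, t]`
  have key : ∀ δ, 0 < δ → δ < t - s →
      U t x ≤ U s y + (x - y) ^ 2 / (2 * (t - s)) + (2 * M + M ^ 2) * δ := by
    intro δ hδ hδt
    have hlipA : ∀ τ, s + δ ≤ τ → ∀ z w,
        |(-meanPotential U δ τ z) - (-meanPotential U δ τ w)| ≤ M * |z - w| := by
      intro τ hτ z w
      rw [neg_sub_neg, abs_sub_comm]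
      exact h.abs_meanPotential_sub_space_le (by linarith) hδ z w
    have hex : ∀ τ, ∃ ξ, s + δ ≤ τ → ∀ z, -meanPotential U δ τ ξ + (ξ - y) ^ 2 / (2 * (τ - s)) ≤
        -meanPotential U δ τ z + (z - y) ^ 2 / (2 * (τ - s)) := by
      intro τ
      by_cases hτ : s + δ ≤ τ
      · obtain ⟨ξ, hξ⟩ := exists_forall_add_sq_div_le hM (hlipA τ hτ) y
          (k := τ - s) (by linarith)
        exact ⟨ξ, fun _ => hξ⟩
      · exact ⟨0, fun h' => absurd h' hτ⟩
    choose ξ hξ using hex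
    have hint : ∫ τ in (s + δ)..t, 1 / 2 * velocityVar u U δ τ (ξ τ) =
        (-meanPotential U δ t (ξ t) + (ξ t - y) ^ 2 / (2 * (t - s))) -
        (-meanPotential U δ (s + δ) (ξ (s + δ)) +
          (ξ (s + δ) - y) ^ 2 / (2 * (s + δ - s))) := by
      refine (integral_deriv_argmin (a := s + δ) (b := t)
        (F := fun τ z => -meanPotential U δ τ z + (z - y) ^ 2 / (2 * (τ - s))) (ξ := ξ)
        (F' := fun τ => 1 / 2 * velocityVar u U δ τ (ξ τ))
        (L := M ^ 2 / 2 + (2 * M * (t - s)) ^ 2 / (2 * δ ^ 2)) (by linarith)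
        (fun τ hτ z => hξ τ hτ.1 z) ?_ ?_).2
      · intro r hr τ₁ h₁ τ₂ h₂
        set z := ξ r
        have hz : |z - y| ≤ 2 * M * (t - s) :=
          (abs_sub_le_of_forall_add_sq_div_le (hlipA r hr.1) (by linarith [hr.1])
            (hξ r hr.1)).trans (by gcongr; exact hr.2)
        have h3 := h.abs_meanPotential_sub_time_le (s := τ₁) (t := τ₂) (by linarith [h₁.1])
          (by linarith [h₂.1]) hδ z
        have h4 := abs_div_sub_div_le (c := (z - y) ^ 2) (C := (2 * M * (t - s)) ^ 2) (δ := δ)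
          (p := τ₂ - s) (q := τ₁ - s) (sq_nonneg _)
          (sq_le_sq.2 (hz.trans (le_abs_self _))) hδ (by linarith [h₂.1]) (by linarith [h₁.1])
        rw [sub_sub_sub_cancel_right] at h4
        rw [abs_le] at *
        constructor <;> linarith [h3.1, h3.2, h4.1, h4.2]
      · intro τ hτ
        have hτs : τ - s ≠ 0 := by linarith [hτ.1]
        have h1 := h.hasDerivAt_meanPotential_time (t := τ) (by linarith [hτ.1]) δ (ξ τ)
        have h2 := deriv_add_div_eq_zero
          (h.hasDerivAt_meanPotential_space (t := τ) (by linarith [hτ.1]) δ (ξ τ)).neg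
          (hξ τ hτ.1.le)
        have h3 : HasDerivAt (fun r => (ξ τ - y) ^ 2 / (2 * (r - s)))
            (-((ξ τ - y) ^ 2 / (2 * (τ - s) ^ 2))) τ := by
          refine ((hasDerivAt_const τ ((ξ τ - y) ^ 2)).div
            (((hasDerivAt_id τ).sub_const s).const_mul 2) (by simpa using hτs)).congr_deriv ?_
          simp only [id]
          field_simp
          ring
        refine (h1.neg.add h3).congr_deriv ?_
        rw [velocityVar, show δ⁻¹ * (U τ (ξ τ + δ) - U τ (ξ τ)) = (ξ τ - y) / (τ - s) by linarith]
        field_simp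
        ring
    have h1 : 0 ≤ ∫ τ in (s + δ)..t, 1 / 2 * velocityVar u U δ τ (ξ τ) := by
      refine intervalIntegral.integral_nonneg (by linarith) fun τ hτ => ?_
      have := h.velocityVar_nonneg (t := τ) (by linarith [hτ.1]) hδ (ξ τ)
      positivity
    have h2 := hξ t (by linarith) x
    set z := ξ (s + δ)
    have h3 := abs_le.1 (h.abs_meanPotential_sub_le (t := s + δ) (by linarith) hδ z)
    have h4 := abs_le.1 (h.abs_sub_time_le (s := s) (t := s + δ) hs (by linarith) z)
    have h5 := abs_le.1 (h.abs_sub_le hs y z)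
    have h6 := abs_le.1 (h.abs_meanPotential_sub_le (t := t) (by linarith) hδ x)
    rw [add_sub_cancel_left, abs_of_pos hδ] at h4
    have h7 : M * |z - y| - (z - y) ^ 2 / (2 * δ) ≤ M ^ 2 / 2 * δ := by
      rw [← sq_abs (z - y)]
      have : M * |z - y| - |z - y| ^ 2 / (2 * δ) - M ^ 2 / 2 * δ =
        -((|z - y| - M * δ) ^ 2 / (2 * δ)) := by field_simp; ring
      have h8 : 0 ≤ (|z - y| - M * δ) ^ 2 / (2 * δ) := by positivity
      linarith
    rw [add_sub_cancel_left] at hint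
    linarith
  refine le_of_forall_pos_le_add fun e he => ?_
  obtain ⟨δ, hδ, hδt, hδe⟩ : ∃ δ, 0 < δ ∧ δ < t - s ∧ (2 * M + M ^ 2) * δ ≤ e := by
    refine ⟨min ((t - s) / 2) (e / (2 * M + M ^ 2 + 1)), ?_, ?_, ?_⟩
    · have : 0 < t - s := by linarith
      positivity
    · exact (min_le_left _ _).trans_lt (by linarith)
    · calc (2 * M + M ^ 2) * min ((t - s) / 2) (e / (2 * M + M ^ 2 + 1))
          ≤ (2 * M + M ^ 2 + 1) * (e / (2 * M + M ^ 2 + 1)) := by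
            have : 0 < t - s := by linarith
            exact mul_le_mul (by linarith) (min_le_right _ _) (by positivity) (by positivity)
        _ = e := by field_simp
  linarith [key δ hδ hδt]

/-- At a minimum point of `U t` plus a smooth function, the Lax condition excludes a jump. -/
theorem leftLim_eq_rightLim_of_isMin (h : IsPotential u U M) {t X k ξ : ℝ} (ht : 0 ≤ t)
    (hξ : ∀ x, U t ξ + (ξ - X) ^ 2 / (2 * k) ≤ U t x + (x - X) ^ 2 / (2 * k)) :
    Function.leftLim (u t) ξ = (X - ξ) / k ∧ Function.rightLim (u t) ξ = (X - ξ) / k := by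
  have hq : HasDerivAt (fun x => (x - X) ^ 2 / (2 * k)) ((ξ - X) / k) ξ := by
    refine ((((hasDerivAt_id ξ).sub_const X).pow 2).div_const (2 * k)).congr_deriv ?_
    simp only [id]
    norm_num
    ring
  have hr := (h.hasDerivWithinAt_right ht ξ).add hq.hasDerivWithinAt
  have hl := (h.hasDerivWithinAt_left ht ξ).add hq.hasDerivWithinAt
  have h1 : 0 ≤ Function.rightLim (u t) ξ + (ξ - X) / k := by
    refine ge_of_tendsto ((hasDerivWithinAt_iff_tendsto_slope' (by simp)).1
      (hr.mono Ioi_subset_Ici_self)) ?_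
    · filter_upwards [self_mem_nhdsWithin] with x hx
      rw [slope_def_field]
      exact div_nonneg (sub_nonneg.2 (hξ x)) (sub_nonneg.2 (le_of_lt hx))
  have h2 : Function.leftLim (u t) ξ + (ξ - X) / k ≤ 0 := by
    refine le_of_tendsto ((hasDerivWithinAt_iff_tendsto_slope' (by simp)).1
      (hl.mono Iio_subset_Iic_self)) ?_
    · filter_upwards [self_mem_nhdsWithin] with x hx
      rw [slope_def_field]
      exact div_nonpos_of_nonneg_of_nonpos (sub_nonneg.2 (hξ x)) (sub_nonpos.2 (le_of_lt hx))
  have h3 := h.lax t ht ξ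
  have h4 : (X - ξ) / k = -((ξ - X) / k) := by ring
  constructor <;> linarith

/-- The lower bound in the Hopf-Lax formula: the minimum over `y` is attained and equals `U t x`.
The Lax condition enters through `leftLim_eq_rightLim_of_isMin`. -/
theorem exists_hopfLax_eq (h : IsPotential u U M) {s t : ℝ} (hs : 0 ≤ s) (hst : s < t) (x : ℝ) :
    ∃ y, U t x = U s y + (x - y) ^ 2 / (2 * (t - s)) := by
  have hM := h.nonneg
  have hlipU : ∀ τ, 0 ≤ τ → ∀ z w, |U τ z - U τ w| ≤ M * |z - w| :=
    fun τ hτ z w => h.abs_sub_le hτ w z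
  obtain ⟨y, hy⟩ := exists_forall_add_sq_div_le hM (hlipU s hs) x (k := t - s) (by linarith)
  refine ⟨y, le_antisymm (h.hopfLax_le hs hst x y) ?_⟩
  rw [show (x - y) ^ 2 = (y - x) ^ 2 by ring]
  -- comparison with the solution `-(z - x) ^ 2 / (2 * (t - τ))` on `[s, b]` for `b < t`
  have key : ∀ b, s < b → b < t →
      U s y + (y - x) ^ 2 / (2 * (t - s)) ≤ U t x + M ^ 2 / 2 * (t - b) := by
    intro b hsb hbt
    set ε : ℕ → ℝ := fun n => 1 / ((n : ℝ) + 1) with hεdef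
    have hε : ∀ n, 0 < ε n := fun n => by positivity
    have hε0 : Tendsto ε atTop (𝓝 0) := tendsto_one_div_add_atTop_nhds_zero_nat
    have hlipA : ∀ n τ, s ≤ τ → ∀ z w,
        |meanPotential U (ε n) τ z - meanPotential U (ε n) τ w| ≤ M * |z - w| :=
      fun n τ hτ z w => h.abs_meanPotential_sub_space_le (hs.trans hτ) (hε n) z w
    have hex : ∀ n τ, ∃ ξ, τ ∈ Icc s b → ∀ z,
        meanPotential U (ε n) τ ξ + (ξ - x) ^ 2 / (2 * (t - τ)) ≤
        meanPotential U (ε n) τ z + (z - x) ^ 2 / (2 * (t - τ)) := by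
      intro n τ
      by_cases hτ : τ ∈ Icc s b
      · obtain ⟨ξ, hξ⟩ := exists_forall_add_sq_div_le hM (hlipA n τ hτ.1) x
          (k := t - τ) (by linarith [hτ.2])
        exact ⟨ξ, fun _ => hξ⟩
      · exact ⟨0, fun h' => absurd h' hτ⟩
    choose ξ hξ using hex
    have hbd : ∀ n, ∀ r ∈ Icc s b, |ξ n r - x| ≤ 2 * M * (t - s) := fun n r hr =>
      (abs_sub_le_of_forall_add_sq_div_le (hlipA n r hr.1) (by linarith [hr.2])
        (hξ n r hr)).trans (by gcongr; exact hr.1)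
    have hint : ∀ n, IntervalIntegrable
          (fun τ => -(1 / 2) * velocityVar u U (ε n) τ (ξ n τ)) volume s b ∧
        ∫ τ in s..b, -(1 / 2) * velocityVar u U (ε n) τ (ξ n τ) =
          (meanPotential U (ε n) b (ξ n b) + (ξ n b - x) ^ 2 / (2 * (t - b))) -
          (meanPotential U (ε n) s (ξ n s) + (ξ n s - x) ^ 2 / (2 * (t - s))) := by
      intro n
      refine integral_deriv_argmin (a := s) (b := b)
        (F := fun τ z => meanPotential U (ε n) τ z + (z - x) ^ 2 / (2 * (t - τ))) (ξ := ξ n)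
        (F' := fun τ => -(1 / 2) * velocityVar u U (ε n) τ (ξ n τ))
        (L := M ^ 2 / 2 + (2 * M * (t - s)) ^ 2 / (2 * (t - b) ^ 2)) hsb.le
        (fun τ hτ z => hξ n τ hτ z) ?_ ?_
      · intro r hr τ₁ h₁ τ₂ h₂
        have h3 := h.abs_meanPotential_sub_time_le (s := τ₁) (t := τ₂) (by linarith [h₁.1])
          (by linarith [h₂.1]) (hε n) (ξ n r)
        have h4 := abs_div_sub_div_le (c := (ξ n r - x) ^ 2) (C := (2 * M * (t - s)) ^ 2)
          (δ := t - b) (p := t - τ₂) (q := t - τ₁) (sq_nonneg _)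
          (sq_le_sq.2 ((hbd n r hr).trans (le_abs_self _))) (by linarith) (by linarith [h₂.2])
          (by linarith [h₁.2])
        rw [sub_sub_sub_cancel_left, abs_sub_comm τ₁ τ₂] at h4
        rw [abs_le] at *
        constructor <;> linarith [h3.1, h3.2, h4.1, h4.2]
      · intro τ hτ
        have hτI : τ ∈ Icc s b := Ioo_subset_Icc_self hτ
        have hτs : t - τ ≠ 0 := by linarith [hτ.2]
        have h1 := h.hasDerivAt_meanPotential_time (t := τ) (by linarith [hτ.1]) (ε n) (ξ n τ)
        have h2 := deriv_add_div_eq_zero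
          (h.hasDerivAt_meanPotential_space (t := τ) (by linarith [hτ.1]) (ε n) (ξ n τ))
          (hξ n τ hτI)
        have h3 : HasDerivAt (fun r => (ξ n τ - x) ^ 2 / (2 * (t - r)))
            ((ξ n τ - x) ^ 2 / (2 * (t - τ) ^ 2)) τ := by
          refine ((hasDerivAt_const τ ((ξ n τ - x) ^ 2)).div
            (((hasDerivAt_id τ).const_sub t).const_mul 2) (by simpa using hτs)).congr_deriv ?_
          simp only [id]
          field_simp
          ring
        refine (h1.add h3).congr_deriv ?_
        rw [velocityVar, show (ε n)⁻¹ * (U τ (ξ n τ + ε n) - U τ (ξ n τ)) =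
          -((ξ n τ - x) / (t - τ)) by linarith]
        field_simp
        ring
    -- the minimum points accumulate at points without a jump
    have hvar : ∀ τ ∈ Ioc s b,
        Tendsto (fun n => velocityVar u U (ε n) τ (ξ n τ)) atTop (𝓝 0) := by
      intro τ hτ
      have hτI : τ ∈ Icc s b := Ioc_subset_Icc_self hτ
      have hτ0 : 0 ≤ τ := hs.trans hτI.1
      refine tendsto_of_subseq_tendsto fun ns hns => ?_
      obtain ⟨ζ, -, φ, hφ, hζ⟩ := (isCompact_Icc (a := x - 2 * M * (t - s))
        (b := x + 2 * M * (t - s))).tendsto_subseq (x := fun k => ξ (ns k) τ) (fun k => by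
          have := abs_le.1 (hbd (ns k) τ hτI)
          constructor <;> linarith)
      have hsub : Tendsto (fun k => ns (φ k)) atTop atTop := hns.comp hφ.tendsto_atTop
      have hε' : Tendsto (fun k => ε (ns (φ k))) atTop (𝓝 0) := hε0.comp hsub
      have hmin : ∀ z, U τ ζ + (ζ - x) ^ 2 / (2 * (t - τ)) ≤
          U τ z + (z - x) ^ 2 / (2 * (t - τ)) := by
        intro z
        have hc := h.continuous hτ0
        have h1 : Tendsto (fun k => U τ (ξ (ns (φ k)) τ) + (ξ (ns (φ k)) τ - x) ^ 2 / (2 * (t - τ))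
            - 2 * (M * ε (ns (φ k)))) atTop
            (𝓝 (U τ ζ + (ζ - x) ^ 2 / (2 * (t - τ)) - 2 * (M * 0))) := by
          refine Tendsto.sub (Tendsto.add ((hc.tendsto ζ).comp hζ) ?_)
            ((hε'.const_mul M).const_mul 2)
          exact ((hζ.sub_const x).pow 2).div_const _
        rw [mul_zero, mul_zero, sub_zero] at h1
        refine le_of_tendsto h1 (Eventually.of_forall fun k => ?_)
        have h2 := hξ (ns (φ k)) τ hτI z
        have h3 := abs_le.1 (h.abs_meanPotential_sub_le hτ0 (hε (ns (φ k))) (ξ (ns (φ k)) τ))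
        have h4 := abs_le.1 (h.abs_meanPotential_sub_le hτ0 (hε (ns (φ k))) z)
        linarith [h3.1, h4.2]
      have hlr := h.leftLim_eq_rightLim_of_isMin hτ0 hmin
      exact ⟨φ, h.tendsto_velocityVar hτ0 (hlr.1.trans hlr.2.symm) hζ hε' fun k => hε _⟩
    have hlim : Tendsto (fun n => ∫ τ in s..b, -(1 / 2) * velocityVar u U (ε n) τ (ξ n τ)) atTop
        (𝓝 (∫ τ in s..b, (0 : ℝ))) := by
      refine intervalIntegral.tendsto_integral_filter_of_dominated_convergence (fun _ => M ^ 2)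
        (Eventually.of_forall fun n => (hint n).1.def'.aestronglyMeasurable)
        (Eventually.of_forall fun n => Eventually.of_forall fun τ hτ => ?_) (by simp)
        (Eventually.of_forall fun τ hτ => ?_)
      · rw [uIoc_of_le hsb.le] at hτ
        have hτ0 : 0 ≤ τ := hs.trans hτ.1.le
        have h1 := h.velocityVar_nonneg hτ0 (hε n) (ξ n τ)
        have h2 := h.velocityVar_le hτ0 (hε n) (ξ n τ) 0 M
          (Eventually.of_forall fun z _ => by rw [sub_zero]; exact h.bound τ hτ0 z)
        rw [Real.norm_eq_abs, abs_le]
        constructor <;> linarith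
      · rw [uIoc_of_le hsb.le] at hτ
        simpa only [mul_zero] using (hvar τ hτ).const_mul (-(1 / 2))
    rw [intervalIntegral.integral_zero] at hlim
    have hlim2 : Tendsto (fun n => U t x + M ^ 2 / 2 * (t - b) + 2 * (M * ε n) -
        ∫ τ in s..b, -(1 / 2) * velocityVar u U (ε n) τ (ξ n τ)) atTop
        (𝓝 (U t x + M ^ 2 / 2 * (t - b) + 2 * (M * 0) - 0)) :=
      (((hε0.const_mul M).const_mul 2).const_add _).sub hlim
    rw [mul_zero, mul_zero, add_zero, sub_zero] at hlim2
    refine ge_of_tendsto hlim2 (Eventually.of_forall fun n => ?_)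
    rw [(hint n).2]
    have h1 := hξ n b ⟨hsb.le, le_rfl⟩ x
    have h2 := abs_le.1 (h.abs_meanPotential_sub_le (t := b) (by linarith) (hε n) x)
    have h3 := abs_le.1 (h.abs_sub_time_le (s := b) (t := t) (by linarith) (by linarith) x)
    have h4 := abs_le.1 (h.abs_meanPotential_sub_le hs (hε n) (ξ n s))
    have h5 := hy (ξ n s)
    rw [abs_of_pos (by linarith)] at h3
    simp only [sub_self] at h1
    norm_num at h1
    linarith
  refine le_of_forall_pos_le_add fun e he => ?_
  have hpos : 0 < t - s := by linarith
  have h1 := key (t - min ((t - s) / 2) (e / (M ^ 2 + 1)))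
    (by linarith [min_le_left ((t - s) / 2) (e / (M ^ 2 + 1))])
    (by
      have : 0 < min ((t - s) / 2) (e / (M ^ 2 + 1)) := by positivity
      linarith)
  have h2 : M ^ 2 / 2 * min ((t - s) / 2) (e / (M ^ 2 + 1)) ≤ e := by
    calc M ^ 2 / 2 * min ((t - s) / 2) (e / (M ^ 2 + 1))
        ≤ (M ^ 2 + 1) * (e / (M ^ 2 + 1)) := by
          gcongr
          · nlinarith [sq_nonneg M]
          · exact min_le_right _ _
      _ = e := by field_simp
  rw [sub_sub_cancel] at h1
  linarith

end IsPotential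

/-! ### Backward characteristics and the forward flow -/

/-- The point `y` is the foot at time `s` of a backward characteristic from `(t, x)`: it attains the
minimum in the Hopf-Lax formula. Only used for `s < t`. -/
def IsFoot (U : ℝ → ℝ → ℝ) (s t x y : ℝ) : Prop := U t x = U s y + (x - y) ^ 2 / (2 * (t - s))

theorem tendsto_leftLim_nhdsGT {f : ℝ → ℝ} (hl : ∀ x, Tendsto f (𝓝[<] x) (𝓝 (Function.leftLim f x)))
    (hr : ∀ x, Tendsto f (𝓝[>] x) (𝓝 (Function.rightLim f x))) (x : ℝ) :
    Tendsto (Function.leftLim f) (𝓝[>] x) (𝓝 (Function.rightLim f x)) := by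
  refine (closed_nhds_basis (Function.rightLim f x)).tendsto_right_iff.2 fun C hC => ?_
  have h1 := (eventually_nhdsWithin_iff.1 (hr x hC.1)).eventually_nhds
  filter_upwards [nhdsWithin_le_nhds h1, self_mem_nhdsWithin] with z hz hxz
  refine hC.2.mem_of_tendsto (hl z) ?_
  filter_upwards [nhdsWithin_le_nhds hz, nhdsWithin_le_nhds (Ioi_mem_nhds hxz)] with w hw hw'
  exact hw hw'

theorem tendsto_rightLim_nhdsLT {f : ℝ → ℝ}
    (hl : ∀ x, Tendsto f (𝓝[<] x) (𝓝 (Function.leftLim f x)))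
    (hr : ∀ x, Tendsto f (𝓝[>] x) (𝓝 (Function.rightLim f x))) (x : ℝ) :
    Tendsto (Function.rightLim f) (𝓝[<] x) (𝓝 (Function.leftLim f x)) := by
  refine (closed_nhds_basis (Function.leftLim f x)).tendsto_right_iff.2 fun C hC => ?_
  have h1 := (eventually_nhdsWithin_iff.1 (hl x hC.1)).eventually_nhds
  filter_upwards [nhdsWithin_le_nhds h1, self_mem_nhdsWithin] with z hz hxz
  refine hC.2.mem_of_tendsto (hr z) ?_
  filter_upwards [nhdsWithin_le_nhds hz, nhdsWithin_le_nhds (Iio_mem_nhds hxz)] with w hw hw'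
  exact hw hw'

namespace IsPotential

variable {u U : ℝ → ℝ → ℝ} {M : ℝ}

theorem abs_leftLim_le (h : IsPotential u U M) {t : ℝ} (ht : 0 ≤ t) (x : ℝ) :
    |Function.leftLim (u t) x| ≤ M :=
  le_of_tendsto (h.tendsto_left t ht x).abs (Eventually.of_forall fun z => h.bound t ht z)

theorem abs_rightLim_le (h : IsPotential u U M) {t : ℝ} (ht : 0 ≤ t) (x : ℝ) :
    |Function.rightLim (u t) x| ≤ M :=
  le_of_tendsto (h.tendsto_right t ht x).abs (Eventually.of_forall fun z => h.bound t ht z)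

theorem tendsto_rightLim_nhdsGE (h : IsPotential u U M) {t : ℝ} (ht : 0 ≤ t) (x : ℝ) :
    Tendsto (Function.rightLim (u t)) (𝓝[≥] x) (𝓝 (Function.rightLim (u t) x)) :=
  continuousWithinAt_rightLim_Ici (h.tendsto_right t ht x)

theorem tendsto_leftLim_nhdsLE (h : IsPotential u U M) {t : ℝ} (ht : 0 ≤ t) (x : ℝ) :
    Tendsto (Function.leftLim (u t)) (𝓝[≤] x) (𝓝 (Function.leftLim (u t) x)) :=
  continuousWithinAt_leftLim_Iic (h.tendsto_left t ht x)

/-- The solution is continuous at the foot of a backward characteristic, and its value there is the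
slope of the characteristic. -/
theorem leftLim_eq_of_isFoot (h : IsPotential u U M) {s t x y : ℝ} (hs : 0 ≤ s) (hst : s < t)
    (hy : IsFoot U s t x y) :
    Function.leftLim (u s) y = (x - y) / (t - s) ∧
      Function.rightLim (u s) y = (x - y) / (t - s) := by
  refine h.leftLim_eq_rightLim_of_isMin hs (X := x) (k := t - s) fun z => ?_
  have h1 := h.hopfLax_le hs hst x z
  rw [hy] at h1
  rw [show (y - x) ^ 2 = (x - y) ^ 2 by ring, show (z - x) ^ 2 = (x - z) ^ 2 by ring]
  exact h1

/-- Backward characteristics do not meet. -/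
theorem foot_lt_foot (h : IsPotential u U M) {s t x x' y y' : ℝ} (hs : 0 ≤ s) (hst : s < t)
    (hx : x < x') (hy : IsFoot U s t x y) (hy' : IsFoot U s t x' y') : y < y' := by
  have h1 := h.hopfLax_le hs hst x y'
  have h2 := h.hopfLax_le hs hst x' y
  rw [hy] at h1
  rw [hy'] at h2
  have hpos : 0 < 2 * (t - s) := by linarith
  have h3 : (x - y) ^ 2 / (2 * (t - s)) + (x' - y') ^ 2 / (2 * (t - s)) ≤
      (x - y') ^ 2 / (2 * (t - s)) + (x' - y) ^ 2 / (2 * (t - s)) := by linarith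
  rw [← add_div, ← add_div, div_le_div_iff_of_pos_right hpos] at h3
  have h4 : y ≤ y' := by nlinarith
  refine lt_of_le_of_ne h4 ?_
  rintro rfl
  have h5 := (h.leftLim_eq_of_isFoot hs hst hy).1.symm.trans (h.leftLim_eq_of_isFoot hs hst hy').1
  rw [div_left_inj' (by linarith)] at h5
  linarith

/-- The foot of a backward characteristic is also a foot for the points in the interior of that
characteristic. -/
theorem isFoot_of_mem_segment (h : IsPotential u U M) {s r t x y : ℝ} (hs : 0 ≤ s) (hsr : s < r)
    (hrt : r < t) (hy : IsFoot U s t x y) :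
    IsFoot U s r (x - (t - r) * ((x - y) / (t - s))) y := by
  have hst : s < t := hsr.trans hrt
  have hts : t - s ≠ 0 := by linarith
  have hrs : r - s ≠ 0 := by linarith
  have htr : t - r ≠ 0 := by linarith
  set z := x - (t - r) * ((x - y) / (t - s)) with hz
  have h1 := h.hopfLax_le (hs.trans hsr.le) hrt x z
  have h2 := h.hopfLax_le hs hsr z y
  rw [hy] at h1
  have h3 : (x - y) ^ 2 / (2 * (t - s)) =
      (x - z) ^ 2 / (2 * (t - r)) + (z - y) ^ 2 / (2 * (r - s)) := by
    have e1 : x - z = (t - r) * ((x - y) / (t - s)) := by rw [hz]; ring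
    have e2 : z - y = (r - s) * ((x - y) / (t - s)) := by
      rw [hz]; field_simp; ring
    rw [e1, e2]
    field_simp
    ring
  exact le_antisymm h2 (by linarith)

/-- The slope of every backward characteristic lies between the one-sided limits of the velocity. -/
theorem slope_mem_of_isFoot (h : IsPotential u U M) {s t x y : ℝ} (hs : 0 ≤ s) (hst : s < t)
    (hy : IsFoot U s t x y) :
    Function.rightLim (u t) x ≤ (x - y) / (t - s) ∧
      (x - y) / (t - s) ≤ Function.leftLim (u t) x := by
  have ht : 0 ≤ t := hs.trans hst.le
  have hq : HasDerivAt (fun z => U s y + (z - y) ^ 2 / (2 * (t - s))) ((x - y) / (t - s)) x := by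
    generalize t - s = k
    refine (((((hasDerivAt_id x).sub_const y).pow 2).div_const (2 * k)).const_add _).congr_deriv ?_
    simp only [id]
    norm_num
    ring
  have hle : ∀ z, 0 ≤ (U s y + (z - y) ^ 2 / (2 * (t - s)) - U t z) -
      (U s y + (x - y) ^ 2 / (2 * (t - s)) - U t x) := fun z => by
    have := h.hopfLax_le hs hst z y
    rw [hy]
    linarith
  have hr := hq.hasDerivWithinAt.sub (h.hasDerivWithinAt_right ht x)
  have hl := hq.hasDerivWithinAt.sub (h.hasDerivWithinAt_left ht x)
  have h1 : 0 ≤ (x - y) / (t - s) - Function.rightLim (u t) x := by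
    refine ge_of_tendsto ((hasDerivWithinAt_iff_tendsto_slope' (by simp)).1
      (hr.mono Ioi_subset_Ici_self)) ?_
    filter_upwards [self_mem_nhdsWithin] with z hz
    rw [slope_def_field]
    exact div_nonneg (hle z) (sub_nonneg.2 (le_of_lt hz))
  have h2 : (x - y) / (t - s) - Function.leftLim (u t) x ≤ 0 := by
    refine le_of_tendsto ((hasDerivWithinAt_iff_tendsto_slope' (by simp)).1
      (hl.mono Iio_subset_Iic_self)) ?_
    filter_upwards [self_mem_nhdsWithin] with z hz
    rw [slope_def_field]
    exact div_nonpos_of_nonneg_of_nonpos (hle z) (sub_nonpos.2 (le_of_lt hz))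
  constructor <;> linarith

/-- Limits of feet are feet: the slopes are given through a limit `p`. -/
theorem isFoot_of_tendsto (h : IsPotential u U M) {s t x p : ℝ} (hs : 0 ≤ s) (hst : s < t)
    {l : Filter ℝ} [l.NeBot] (hl : l ≤ 𝓝 x) {y : ℝ → ℝ} (hy : ∀ z, IsFoot U s t z (y z))
    (hp : Tendsto (fun z => (z - y z) / (t - s)) l (𝓝 p)) :
    IsFoot U s t x (x - (t - s) * p) := by
  have hts : t - s ≠ 0 := by linarith
  have hx : Tendsto (fun z : ℝ => z) l (𝓝 x) := hl
  have h1 : Tendsto y l (𝓝 (x - (t - s) * p)) := by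
    refine (hx.sub (hp.const_mul (t - s))).congr fun z => ?_
    field_simp
    ring
  have h2 : Tendsto (fun z => U s (y z) + (z - y z) ^ 2 / (2 * (t - s))) l
      (𝓝 (U s (x - (t - s) * p) + (x - (x - (t - s) * p)) ^ 2 / (2 * (t - s)))) :=
    (((h.continuous hs).tendsto _).comp h1).add (((hx.sub h1).pow 2).div_const _)
  have h3 : Tendsto (U t) l (𝓝 (U t x)) := ((h.continuous (hs.trans hst.le)).tendsto x).mono_left hl
  exact tendsto_nhds_unique h3 (h2.congr fun z => (hy z).symm)

/-- The one-sided limits of the velocity are slopes of backward characteristics. -/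
theorem isFoot_rightLim (h : IsPotential u U M) {s t : ℝ} (hs : 0 ≤ s) (hst : s < t) (x : ℝ) :
    IsFoot U s t x (x - (t - s) * Function.rightLim (u t) x) := by
  have ht : 0 ≤ t := hs.trans hst.le
  choose y hy using h.exists_hopfLax_eq hs hst
  refine h.isFoot_of_tendsto hs hst (l := 𝓝[>] x) nhdsWithin_le_nhds hy ?_
  exact tendsto_of_tendsto_of_tendsto_of_le_of_le
    ((h.tendsto_rightLim_nhdsGE ht x).mono_left (nhdsWithin_mono _ Ioi_subset_Ici_self))
    (tendsto_leftLim_nhdsGT (h.tendsto_left t ht) (h.tendsto_right t ht) x)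
    (fun z => (h.slope_mem_of_isFoot hs hst (hy z)).1)
    (fun z => (h.slope_mem_of_isFoot hs hst (hy z)).2)

theorem isFoot_leftLim (h : IsPotential u U M) {s t : ℝ} (hs : 0 ≤ s) (hst : s < t) (x : ℝ) :
    IsFoot U s t x (x - (t - s) * Function.leftLim (u t) x) := by
  have ht : 0 ≤ t := hs.trans hst.le
  choose y hy using h.exists_hopfLax_eq hs hst
  refine h.isFoot_of_tendsto hs hst (l := 𝓝[<] x) nhdsWithin_le_nhds hy ?_
  exact tendsto_of_tendsto_of_tendsto_of_le_of_le
    (tendsto_rightLim_nhdsLT (h.tendsto_left t ht) (h.tendsto_right t ht) x)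
    ((h.tendsto_leftLim_nhdsLE ht x).mono_left (nhdsWithin_mono _ Iio_subset_Iic_self))
    (fun z => (h.slope_mem_of_isFoot hs hst (hy z)).1)
    (fun z => (h.slope_mem_of_isFoot hs hst (hy z)).2)

/-- Oleinik's one-sided Lipschitz estimate. -/
theorem ubar_sub_le (h : IsPotential u U M) {t x z : ℝ} (ht : 0 < t) (hxz : x < z) :
    ubar u t z - ubar u t x ≤ (z - x) / t := by
  have h1 := h.foot_lt_foot le_rfl ht hxz (h.isFoot_rightLim le_rfl ht x)
    (h.isFoot_leftLim le_rfl ht z)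
  have h2 := h.lax t ht.le x
  have h3 := h.lax t ht.le z
  rw [le_div_iff₀ ht, ubar, ubar]
  nlinarith

end IsPotential

/-- The extreme backward characteristics from `(t, x)` enclose `b` at time `s`. This turns out to be
the forward flow, see `IsPotential.flowsTo_iff_reaches`, but it does not refer to curves. -/
def Reaches (u : ℝ → ℝ → ℝ) (s b t x : ℝ) : Prop :=
  x - (t - s) * Function.leftLim (u t) x ≤ b ∧ b ≤ x - (t - s) * Function.rightLim (u t) x

theorem reaches_self_iff {u : ℝ → ℝ → ℝ} {s b x : ℝ} : Reaches u s b s x ↔ x = b := by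
  simp [Reaches, le_antisymm_iff]

namespace IsPotential

variable {u U : ℝ → ℝ → ℝ} {M : ℝ}

theorem le_of_reaches (h : IsPotential u U M) {s t b b' x x' : ℝ} (hs : 0 ≤ s) (hst : s ≤ t)
    (hb : b ≤ b') (hx : Reaches u s b t x) (hx' : Reaches u s b' t x') : x ≤ x' := by
  rcases hst.eq_or_lt with rfl | hst
  · rw [reaches_self_iff] at hx hx'
    rwa [hx, hx']
  · by_contra hlt
    have := h.foot_lt_foot hs hst (not_le.1 hlt) (h.isFoot_rightLim hs hst x')
      (h.isFoot_leftLim hs hst x)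
    linarith [hx.1, hx'.2]

theorem reaches_unique (h : IsPotential u U M) {s t b x x' : ℝ} (hs : 0 ≤ s) (hst : s ≤ t)
    (hx : Reaches u s b t x) (hx' : Reaches u s b t x') : x = x' :=
  le_antisymm (h.le_of_reaches hs hst le_rfl hx hx') (h.le_of_reaches hs hst le_rfl hx' hx)

/-- The extreme feet of the positions at time `t` leave no gap: at the last position whose left foot
does not exceed `b`, the right foot is at least `b`, because the left feet converge to it from the
right. -/
theorem exists_reaches (h : IsPotential u U M) {s t : ℝ} (hs : 0 ≤ s) (hst : s ≤ t) (b : ℝ) :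
    ∃ x, Reaches u s b t x := by
  rcases hst.eq_or_lt with rfl | hst
  · exact ⟨b, reaches_self_iff.2 rfl⟩
  have ht : 0 ≤ t := hs.trans hst.le
  set y : ℝ → ℝ := fun x => x - (t - s) * Function.leftLim (u t) x with hy
  set S : Set ℝ := {x | y x ≤ b} with hS
  have hts : 0 < t - s := by linarith
  have hne : S.Nonempty := by
    refine ⟨b - (t - s) * M, ?_⟩
    have := (abs_le.1 (h.abs_leftLim_le ht (b - (t - s) * M))).1
    simp only [hS, hy, mem_ofPred_eq]
    nlinarith
  have hbdd : BddAbove S := by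
    refine ⟨b + (t - s) * M, fun x hx => ?_⟩
    have := (abs_le.1 (h.abs_leftLim_le ht x)).2
    simp only [hS, hy, mem_ofPred_eq] at hx
    nlinarith
  have hleft : Tendsto y (𝓝[≤] sSup S) (𝓝 (y (sSup S))) :=
    (tendsto_id.mono_left nhdsWithin_le_nhds).sub
      ((h.tendsto_leftLim_nhdsLE ht _).const_mul (t - s))
  have hright : Tendsto y (𝓝[>] sSup S)
      (𝓝 (sSup S - (t - s) * Function.rightLim (u t) (sSup S))) :=
    (tendsto_id.mono_left nhdsWithin_le_nhds).sub
      ((tendsto_leftLim_nhdsGT (h.tendsto_left t ht) (h.tendsto_right t ht) _).const_mul (t - s))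
  refine ⟨sSup S, ?_, ?_⟩
  · refine le_of_tendsto_of_frequently hleft ?_
    exact (isLUB_csSup hne hbdd).frequently_mem hne
  · refine ge_of_tendsto hright ?_
    filter_upwards [self_mem_nhdsWithin] with z hz
    have : z ∉ S := notMem_of_csSup_lt hz hbdd
    exact (not_le.1 this).le

/-- Flow property of `Reaches`. -/
theorem reaches_of_reaches (h : IsPotential u U M) {s t t' b x x' : ℝ} (hs : 0 ≤ s) (hst : s ≤ t)
    (htt' : t ≤ t') (hx : Reaches u s b t x) (hx' : Reaches u s b t' x') :
    Reaches u t x t' x' := by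
  rcases hst.eq_or_lt with rfl | hst
  · rw [reaches_self_iff] at hx
    rwa [hx]
  rcases htt'.eq_or_lt with rfl | htt'
  · exact reaches_self_iff.2 (h.reaches_unique hs hst.le hx' hx)
  have hst' : s < t' := hst.trans htt'
  have hts : t' - s ≠ 0 := by linarith
  constructor
  · by_contra hcon
    rw [not_le] at hcon
    have h1 := h.isFoot_of_mem_segment hs hst htt' (h.isFoot_leftLim hs hst' x')
    rw [sub_sub_cancel, mul_div_cancel_left₀ _ hts] at h1
    have := h.foot_lt_foot hs hst hcon (h.isFoot_rightLim hs hst x) h1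
    linarith [hx.2, hx'.1]
  · by_contra hcon
    rw [not_le] at hcon
    have h1 := h.isFoot_of_mem_segment hs hst htt' (h.isFoot_rightLim hs hst' x')
    rw [sub_sub_cancel, mul_div_cancel_left₀ _ hts] at h1
    have := h.foot_lt_foot hs hst hcon h1 (h.isFoot_leftLim hs hst x)
    linarith [hx.1, hx'.2]

theorem reaches_trans (h : IsPotential u U M) {s t t' b x x' : ℝ} (hs : 0 ≤ s) (hst : s ≤ t)
    (htt' : t ≤ t') (hx : Reaches u s b t x) (hx' : Reaches u t x t' x') :
    Reaches u s b t' x' := by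
  obtain ⟨x'', hx''⟩ := h.exists_reaches hs (hst.trans htt') b
  rwa [h.reaches_unique (hs.trans hst) htt' hx' (h.reaches_of_reaches hs hst htt' hx hx'')]

theorem abs_sub_le_of_reaches (h : IsPotential u U M) {s t b x : ℝ} (hs : 0 ≤ s) (hst : s ≤ t)
    (hx : Reaches u s b t x) : |x - b| ≤ M * (t - s) := by
  have h1 := abs_le.1 (h.abs_leftLim_le (hs.trans hst) x)
  have h2 := abs_le.1 (h.abs_rightLim_le (hs.trans hst) x)
  have h3 : 0 ≤ t - s := by linarith
  rw [abs_le]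
  constructor <;> nlinarith [hx.1, hx.2]

end IsPotential

/-! ### Generalized characteristics -/

theorem IsGenChar.mono {u : ℝ → ℝ → ℝ} {s s' T' T : ℝ} {X : ℝ → ℝ} (hX : IsGenChar u s T X)
    (hs : s ≤ s') (hT : T' ≤ T) : IsGenChar u s' T' X where
  continuousOn := hX.continuousOn.mono (Icc_subset_Icc hs hT)
  rightDeriv t ht := hX.rightDeriv t ⟨hs.trans ht.1, ht.2.trans_le hT⟩

namespace IsPotential

variable {u U : ℝ → ℝ → ℝ} {M : ℝ}

/-- If the distance `D` of two generalized characteristics is positive on `(a, b]`, then `D t / t`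
is nonincreasing there by Oleinik's estimate; as it tends to `0` at `a`, this is impossible. -/
theorem le_of_isGenChar (h : IsPotential u U M) {s T : ℝ} {X Z : ℝ → ℝ} (hs : 0 ≤ s)
    (hX : IsGenChar u s T X) (hZ : IsGenChar u s T Z) (h0 : X s = Z s) {b : ℝ}
    (hb : b ∈ Icc s T) : Z b ≤ X b := by
  by_contra hcon
  rw [not_le] at hcon
  set D : ℝ → ℝ := fun t => Z t - X t with hD
  have hDc : ContinuousOn D (Icc s T) := hZ.continuousOn.sub hX.continuousOn
  have hDd : ∀ t ∈ Ico s T, HasDerivWithinAt D (ubar u t (Z t) - ubar u t (X t)) (Ioi t) t :=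
    fun t ht => (hZ.rightDeriv t ht).sub (hX.rightDeriv t ht)
  -- the last time `a` before `b` at which the curves coincide
  set S : Set ℝ := {t | t ∈ Icc s b ∧ D t ≤ 0} with hS
  have hSs : s ∈ S := ⟨⟨le_rfl, hb.1⟩, by simp [hD, h0]⟩
  have hSclosed : IsClosed S :=
    (hDc.mono (Icc_subset_Icc_right hb.2)).preimage_isClosed_of_isClosed isClosed_Icc isClosed_Iic
  have hSbdd : BddAbove S := ⟨b, fun t ht => ht.1.2⟩
  set a := sSup S with ha
  have haS : a ∈ S := hSclosed.csSup_mem ⟨s, hSs⟩ hSbdd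
  have hab : a < b := by
    refine lt_of_le_of_ne haS.1.2 fun hab => ?_
    have := haS.2
    rw [hab] at this
    simp only [hD] at this
    linarith
  have hpos : ∀ t ∈ Ioc a b, 0 < D t := fun t ht => by
    by_contra hle
    exact absurd (le_csSup hSbdd (⟨⟨haS.1.1.trans ht.1.le, ht.2⟩, not_lt.1 hle⟩ : t ∈ S))
      (not_le.2 ht.1)
  have haT : a ∈ Ico s T := ⟨haS.1.1, hab.trans_le hb.2⟩
  have ha0 : 0 ≤ a := hs.trans haT.1
  have hDa : D a = 0 := by
    refine le_antisymm haS.2 ?_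
    have h1 : Tendsto D (𝓝[Ioc a b] a) (𝓝 (D a)) :=
      (hDc a (Ico_subset_Icc_self haT)).mono (fun t ht => ⟨haT.1.trans ht.1.le, ht.2.trans hb.2⟩)
    rw [nhdsWithin_Ioc_eq_nhdsGT hab] at h1
    refine ge_of_tendsto h1 ?_
    filter_upwards [Ioc_mem_nhdsGT hab] with t ht using (hpos t ht).le
  have hanti : ∀ c ∈ Ioo a b, D b / b ≤ D c / c := by
    intro c hc
    have hc0 : 0 < c := ha0.trans_lt hc.1
    refine image_le_of_deriv_right_le_deriv_boundary (f := fun t => D t / t)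
      (f' := fun t => ((ubar u t (Z t) - ubar u t (X t)) * t - D t * 1) / t ^ 2)
      (B := fun _ => D c / c) (B' := fun _ => 0) (a := c) (b := b)
      ?_ ?_ le_rfl continuousOn_const (fun t _ => hasDerivWithinAt_const _ _ _) ?_
      ⟨hc.2.le, le_rfl⟩
    · refine (hDc.mono (Icc_subset_Icc (haT.1.trans hc.1.le) hb.2)).div continuousOn_id ?_
      intro t ht
      exact (hc0.trans_le ht.1).ne'
    · intro t ht
      refine HasDerivWithinAt.div ?_ (hasDerivWithinAt_id _ _) (by linarith [ht.1])
      exact hasDerivWithinAt_Ioi_iff_Ici.1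
        (hDd t ⟨(haT.1.trans hc.1.le).trans ht.1, ht.2.trans_le hb.2⟩)
    · intro t ht
      have ht0 : 0 < t := hc0.trans_le ht.1
      have hDt := hpos t ⟨hc.1.trans_le ht.1, ht.2.le⟩
      have h1 := h.ubar_sub_le ht0 (sub_pos.1 hDt)
      rw [le_div_iff₀ ht0] at h1
      exact div_nonpos_of_nonpos_of_nonneg (by simp only [hD]; linarith) (sq_nonneg t)
  have hlim : Tendsto (fun c => D c / c) (𝓝[>] a) (𝓝 0) := by
    have hder := hDd a haT
    have hXZ : Z a = X a := sub_eq_zero.1 hDa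
    rw [hXZ, sub_self] at hder
    rcases ha0.eq_or_lt with ha0 | ha0
    · have := (hasDerivWithinAt_iff_tendsto_slope' (by simp)).1 hder
      refine this.congr fun c => ?_
      rw [slope_def_field, hDa, ← ha0, sub_zero, sub_zero]
    · have h1 : Tendsto D (𝓝[>] a) (𝓝 (D a)) := hder.continuousWithinAt
      have h2 : Tendsto (fun c : ℝ => c) (𝓝[>] a) (𝓝 a) := nhdsWithin_le_nhds
      have h3 := h1.div h2 ha0.ne'
      rwa [hDa, zero_div] at h3
  have h1 : D b / b ≤ 0 := by
    refine ge_of_tendsto hlim ?_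
    filter_upwards [Ioo_mem_nhdsGT hab] with c hc using hanti c hc
  have h2 : 0 < D b / b := div_pos (hpos b ⟨hab, le_rfl⟩) (ha0.trans_lt hab)
  linarith

/-- Forward uniqueness of generalized characteristics. -/
theorem eq_of_isGenChar (h : IsPotential u U M) {s T : ℝ} {X Z : ℝ → ℝ} (hs : 0 ≤ s)
    (hX : IsGenChar u s T X) (hZ : IsGenChar u s T Z) (h0 : X s = Z s) {b : ℝ}
    (hb : b ∈ Icc s T) : X b = Z b :=
  le_antisymm (h.le_of_isGenChar hs hZ hX h0.symm hb) (h.le_of_isGenChar hs hX hZ h0 hb)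

/-- The momentum between the two extreme feet, which is computed from the Hopf-Lax formula. -/
theorem potential_sub_potential (h : IsPotential u U M) {s t : ℝ} (hs : 0 ≤ s) (hst : s < t)
    (x : ℝ) :
    U s (x - (t - s) * Function.rightLim (u t) x) - U s (x - (t - s) * Function.leftLim (u t) x) =
      (t - s) * (Function.leftLim (u t) x ^ 2 - Function.rightLim (u t) x ^ 2) / 2 := by
  have hts : t - s ≠ 0 := by linarith
  have h1 := h.isFoot_rightLim hs hst x
  have h2 := h.isFoot_leftLim hs hst x
  rw [IsFoot, sub_sub_cancel] at h1 h2
  have h3 : ∀ p : ℝ, ((t - s) * p) ^ 2 / (2 * (t - s)) = (t - s) * p ^ 2 / 2 := fun p => by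
    field_simp
  rw [h3] at h1 h2
  linarith

/-- A curve which is enclosed by the backward characteristics from its later points moves with the
averaged velocity: this is the Rankine-Hugoniot condition. -/
theorem hasDerivWithinAt_of_reaches (h : IsPotential u U M) {t T : ℝ} {Z : ℝ → ℝ} (ht : 0 ≤ t)
    (htT : t < T) (hZ : ∀ r ∈ Icc t T, Reaches u t (Z t) r (Z r)) :
    HasDerivWithinAt Z (ubar u t (Z t)) (Ioi t) t := by
  set w := Z t with hw
  set zr : ℝ → ℝ := fun r => Z r - (r - t) * Function.rightLim (u r) (Z r) with hzr
  set zl : ℝ → ℝ := fun r => Z r - (r - t) * Function.leftLim (u r) (Z r) with hzl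
  set pr : ℝ → ℝ := fun r => Function.rightLim (u r) (Z r) with hpr
  set pl : ℝ → ℝ := fun r => Function.leftLim (u r) (Z r) with hpl
  set σ : ℝ → ℝ := fun r => (Z r - w) / (r - t) with hσ
  have hM := h.nonneg
  have hmem : ∀ᶠ r in 𝓝[>] t, r ∈ Ioc t T := Ioc_mem_nhdsGT htT
  have hle : ∀ r ∈ Ioc t T, zl r ≤ w ∧ w ≤ zr r := fun r hr => hZ r (Ioc_subset_Icc_self hr)
  have hbd : ∀ r ∈ Ioc t T, |zr r - w| ≤ 2 * M * (r - t) ∧ |zl r - w| ≤ 2 * M * (r - t) := by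
    intro r hr
    have hrt : 0 < r - t := by linarith [hr.1]
    have h0 := abs_le.1 (h.abs_sub_le_of_reaches ht hr.1.le (hZ r (Ioc_subset_Icc_self hr)))
    have h1 := abs_le.1 (h.abs_leftLim_le (ht.trans hr.1.le) (Z r))
    have h2 := abs_le.1 (h.abs_rightLim_le (ht.trans hr.1.le) (Z r))
    constructor <;> rw [abs_le] <;> constructor <;> simp only [hzr, hzl] <;> nlinarith
  have hlim0 : Tendsto (fun r => 2 * M * (r - t)) (𝓝[>] t) (𝓝 0) := by
    have : Tendsto (fun r => 2 * M * (r - t)) (𝓝 t) (𝓝 (2 * M * (t - t))) :=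
      (Continuous.tendsto (by fun_prop) t)
    rw [sub_self, mul_zero] at this
    exact this.mono_left nhdsWithin_le_nhds
  have hzr_lim : Tendsto zr (𝓝[>] t) (𝓝[≥] w) := by
    refine tendsto_nhdsWithin_iff.2 ⟨?_, hmem.mono fun r hr => (hle r hr).2⟩
    rw [tendsto_iff_dist_tendsto_zero]
    exact squeeze_zero' (Eventually.of_forall fun _ => dist_nonneg)
      (hmem.mono fun r hr => (hbd r hr).1) hlim0
  have hzl_lim : Tendsto zl (𝓝[>] t) (𝓝[≤] w) := by
    refine tendsto_nhdsWithin_iff.2 ⟨?_, hmem.mono fun r hr => (hle r hr).1⟩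
    rw [tendsto_iff_dist_tendsto_zero]
    exact squeeze_zero' (Eventually.of_forall fun _ => dist_nonneg)
      (hmem.mono fun r hr => (hbd r hr).2) hlim0
  have hpr_lim : Tendsto pr (𝓝[>] t) (𝓝 (Function.rightLim (u t) w)) := by
    refine ((h.tendsto_rightLim_nhdsGE ht w).comp hzr_lim).congr' ?_
    filter_upwards [hmem] with r hr
    have := (h.leftLim_eq_of_isFoot ht hr.1 (h.isFoot_rightLim ht hr.1 (Z r))).2
    rwa [sub_sub_cancel, mul_div_cancel_left₀ _ (by linarith [hr.1])] at this
  have hpl_lim : Tendsto pl (𝓝[>] t) (𝓝 (Function.leftLim (u t) w)) := by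
    refine ((h.tendsto_leftLim_nhdsLE ht w).comp hzl_lim).congr' ?_
    filter_upwards [hmem] with r hr
    have := (h.leftLim_eq_of_isFoot ht hr.1 (h.isFoot_leftLim ht hr.1 (Z r))).1
    rwa [sub_sub_cancel, mul_div_cancel_left₀ _ (by linarith [hr.1])] at this
  have hσ_lim : Tendsto σ (𝓝[>] t) (𝓝 (ubar u t w)) := by
    rcases (h.lax t ht w).eq_or_lt with heq | hlt
    · have hu : ubar u t w = Function.rightLim (u t) w := by rw [ubar, ← heq]; ring
      rw [hu]
      refine tendsto_of_tendsto_of_tendsto_of_le_of_le' hpr_lim (heq ▸ hpl_lim) ?_ ?_ <;>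
      · filter_upwards [hmem] with r hr
        have := hle r hr
        simp only [hzl, hzr] at this
        simp only [hσ, hpl, hpr]
        first
          | rw [le_div_iff₀ (by linarith [hr.1])]; linarith
          | rw [div_le_iff₀ (by linarith [hr.1])]; linarith
    · set A := Function.leftLim (u t) w
      set B := Function.rightLim (u t) w
      have hAB : A - B ≠ 0 := by linarith
      have hO : ∀ z : ℝ → ℝ, (∀ r ∈ Ioc t T, |z r - w| ≤ 2 * M * (r - t)) →
          (fun r => z r - w) =O[𝓝[>] t] fun r => r - t := fun z hz =>
        Asymptotics.IsBigO.of_bound (2 * M) <| hmem.mono fun r hr => by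
          rw [Real.norm_eq_abs, Real.norm_eq_abs, abs_of_pos (a := r - t) (by linarith [hr.1])]
          exact hz r hr
      have he1 : Tendsto (fun r => (U t (zr r) - U t w - (zr r - w) * B) / (r - t)) (𝓝[>] t)
          (𝓝 0) := by
        refine Asymptotics.IsLittleO.tendsto_div_nhds_zero ?_
        have := (hasDerivWithinAt_iff_isLittleO.1 (h.hasDerivWithinAt_right ht w)).comp_tendsto
          hzr_lim
        exact this.trans_isBigO (hO zr fun r hr => (hbd r hr).1)
      have he2 : Tendsto (fun r => (U t (zl r) - U t w - (zl r - w) * A) / (r - t)) (𝓝[>] t)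
          (𝓝 0) := by
        refine Asymptotics.IsLittleO.tendsto_div_nhds_zero ?_
        have := (hasDerivWithinAt_iff_isLittleO.1 (h.hasDerivWithinAt_left ht w)).comp_tendsto
          hzl_lim
        exact this.trans_isBigO (hO zl fun r hr => (hbd r hr).2)
      have hmain : Tendsto (fun r => (A * pl r - B * pr r - (pl r ^ 2 - pr r ^ 2) / 2 +
          (U t (zr r) - U t w - (zr r - w) * B) / (r - t) -
          (U t (zl r) - U t w - (zl r - w) * A) / (r - t)) / (A - B)) (𝓝[>] t)
          (𝓝 ((A * A - B * B - (A ^ 2 - B ^ 2) / 2 + 0 - 0) / (A - B))) :=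
        (((((hpl_lim.const_mul A).sub (hpr_lim.const_mul B)).sub
          (((hpl_lim.pow 2).sub (hpr_lim.pow 2)).div_const 2)).add he1).sub he2).div_const _
      have hval : (A * A - B * B - (A ^ 2 - B ^ 2) / 2 + 0 - 0) / (A - B) = ubar u t w := by
        rw [ubar, div_eq_iff hAB]
        ring
      rw [hval] at hmain
      refine hmain.congr' ?_
      filter_upwards [hmem] with r hr
      have hrt : r - t ≠ 0 := by linarith [hr.1]
      have hpot := h.potential_sub_potential ht hr.1 (Z r)
      have h1 : U t (zr r) = U t (zl r) + (r - t) * (pl r ^ 2 - pr r ^ 2) / 2 := by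
        simp only [hzr, hzl, hpl, hpr]
        linarith
      rw [h1, div_eq_iff hAB]
      have h2 : zr r = Z r - (r - t) * pr r := rfl
      have h3 : zl r = Z r - (r - t) * pl r := rfl
      generalize U t (zl r) = V
      rw [h2, h3]
      simp only [hσ]
      field_simp
      ring
  rw [hasDerivWithinAt_iff_tendsto_slope' (by simp)]
  refine hσ_lim.congr fun r => ?_
  rw [slope_def_field]

theorem isGenChar_of_reaches (h : IsPotential u U M) {s T b : ℝ} {Z : ℝ → ℝ} (hs : 0 ≤ s)
    (hZ : ∀ r ∈ Icc s T, Reaches u s b r (Z r)) : IsGenChar u s T Z where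
  continuousOn := by
    have : LipschitzOnWith ⟨M, h.nonneg⟩ Z (Icc s T) := by
      refine LipschitzOnWith.of_dist_le_mul fun x hx y hy => ?_
      rw [Real.dist_eq, Real.dist_eq]
      change |Z x - Z y| ≤ M * |x - y|
      rcases le_total x y with hxy | hxy
      · have := h.abs_sub_le_of_reaches (hs.trans hx.1) hxy
          (h.reaches_of_reaches hs hx.1 hxy (hZ x hx) (hZ y hy))
        rwa [abs_sub_comm, abs_sub_comm x y, abs_of_nonneg (sub_nonneg.2 hxy)]
      · have := h.abs_sub_le_of_reaches (hs.trans hy.1) hxy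
          (h.reaches_of_reaches hs hy.1 hxy (hZ y hy) (hZ x hx))
        rwa [abs_of_nonneg (sub_nonneg.2 hxy)]
    exact this.continuousOn
  rightDeriv t ht := h.hasDerivWithinAt_of_reaches (hs.trans ht.1) ht.2 fun r hr =>
    h.reaches_of_reaches hs ht.1 hr.1 (hZ t (Ico_subset_Icc_self ht)) (hZ r ⟨ht.1.trans hr.1, hr.2⟩)

theorem reaches_of_isGenChar (h : IsPotential u U M) {s T : ℝ} {X : ℝ → ℝ} (hs : 0 ≤ s)
    (hsT : s ≤ T) (hX : IsGenChar u s T X) : Reaches u s (X s) T (X T) := by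
  have hex : ∀ r, ∃ z, r ∈ Icc s T → Reaches u s (X s) r z := fun r => by
    by_cases hr : r ∈ Icc s T
    · obtain ⟨z, hz⟩ := h.exists_reaches hs hr.1 (X s)
      exact ⟨z, fun _ => hz⟩
    · exact ⟨0, fun h' => absurd h' hr⟩
  choose Z hZ using hex
  have h0 : Z s = X s := reaches_self_iff.1 (hZ s ⟨le_rfl, hsT⟩)
  rw [h.eq_of_isGenChar hs hX (h.isGenChar_of_reaches hs hZ) h0.symm ⟨hsT, le_rfl⟩]
  exact hZ T ⟨hsT, le_rfl⟩

/-- The forward flow in terms of the backward characteristics from the final point. -/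
theorem flowsTo_iff_reaches (h : IsPotential u U M) {s T b x : ℝ} (hs : 0 ≤ s) (hsT : s ≤ T) :
    FlowsTo u s b T x ↔ Reaches u s b T x := by
  constructor
  · rintro ⟨X, hX, rfl, rfl⟩
    exact h.reaches_of_isGenChar hs hsT hX
  · intro hb
    have hex : ∀ r, ∃ z, r ∈ Icc s T → Reaches u s b r z := fun r => by
      by_cases hr : r ∈ Icc s T
      · obtain ⟨z, hz⟩ := h.exists_reaches hs hr.1 b
        exact ⟨z, fun _ => hz⟩
      · exact ⟨0, fun h' => absurd h' hr⟩
    choose Z hZ using hex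
    exact ⟨Z, h.isGenChar_of_reaches hs hZ, reaches_self_iff.1 (hZ s ⟨le_rfl, hsT⟩),
      h.reaches_unique hs hsT (hZ T ⟨hsT, le_rfl⟩) hb⟩

end IsPotential

/-! ### Velocity and momentum along the flow -/

namespace IsPotential

variable {u U : ℝ → ℝ → ℝ} {M : ℝ}

theorem measurable_ubar (h : IsPotential u U M) {t : ℝ} (ht : 0 ≤ t) : Measurable (ubar u t) := by
  have hseq : Tendsto (fun n : ℕ => 1 / ((n : ℝ) + 1)) atTop (𝓝 0) :=
    tendsto_one_div_add_atTop_nhds_zero_nat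
  have hr : Measurable (Function.rightLim (u t)) := by
    refine measurable_of_tendsto_metrizable
      (f := fun n : ℕ => fun x => u t (x + 1 / ((n : ℝ) + 1)))
      (fun n => (h.meas t ht).comp (measurable_add_const _)) (tendsto_pi_nhds.2 fun x => ?_)
    refine (h.tendsto_right t ht x).comp (tendsto_nhdsWithin_iff.2 ⟨?_, Eventually.of_forall ?_⟩)
    · simpa using hseq.const_add x
    · intro n
      have : 0 < 1 / ((n : ℝ) + 1) := by positivity
      simpa using this
  have hl : Measurable (Function.leftLim (u t)) := by
    refine measurable_of_tendsto_metrizable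
      (f := fun n : ℕ => fun x => u t (x - 1 / ((n : ℝ) + 1)))
      (fun n => (h.meas t ht).comp (measurable_sub_const _)) (tendsto_pi_nhds.2 fun x => ?_)
    refine (h.tendsto_left t ht x).comp (tendsto_nhdsWithin_iff.2 ⟨?_, Eventually.of_forall ?_⟩)
    · simpa using hseq.const_sub x
    · intro n
      have : 0 < 1 / ((n : ℝ) + 1) := by positivity
      simpa using this
  exact (hr.add hl).div_const 2

theorem abs_ubar_le (h : IsPotential u U M) {t : ℝ} (ht : 0 ≤ t) (x : ℝ) : |ubar u t x| ≤ M := by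
  have h1 := abs_le.1 (h.abs_leftLim_le ht x)
  have h2 := abs_le.1 (h.abs_rightLim_le ht x)
  rw [ubar, abs_le]
  constructor <;> linarith

theorem integral_ubar (h : IsPotential u U M) {t : ℝ} (ht : 0 ≤ t) (a b : ℝ) :
    IntervalIntegrable (ubar u t) volume a b ∧ ∫ x in a..b, ubar u t x = U t b - U t a := by
  have hL : LipschitzWith ⟨M, h.nonneg⟩ (U t) := LipschitzWith.of_dist_le_mul fun x y => by
    rw [Real.dist_eq, Real.dist_eq]
    exact h.abs_sub_le ht y x
  have hac := (hL.lipschitzOnWith (s := uIcc a b)).absolutelyContinuousOnInterval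
  have hae : ∀ᵐ x, x ∈ uIoc a b → deriv (U t) x = ubar u t x := by
    filter_upwards [hac.ae_differentiableAt] with x hx hmem
    have hd := (hx (uIoc_subset_uIcc hmem)).hasDerivAt
    have h1 := (uniqueDiffWithinAt_Ici x).eq_deriv _ hd.hasDerivWithinAt
      (h.hasDerivWithinAt_right ht x)
    have h2 := (uniqueDiffWithinAt_Iic x).eq_deriv _ hd.hasDerivWithinAt
      (h.hasDerivWithinAt_left ht x)
    rw [ubar, ← h1, ← h2]
    ring
  refine ⟨hac.intervalIntegrable_deriv.congr_ae
    ((ae_restrict_iff' measurableSet_uIoc).2 hae), ?_⟩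
  rw [← hac.integral_deriv_eq_sub]
  exact (intervalIntegral.integral_congr_ae hae).symm

/-- The intervals at time `0` that are swallowed by different shocks are disjoint. -/
theorem countable_isShock (h : IsPotential u U M) {t : ℝ} (ht : 0 < t) :
    {x | IsShock u t x}.Countable := by
  refine PairwiseDisjoint.countable_of_isOpen
    (s := fun x => Ioo (x - (t - 0) * Function.leftLim (u t) x)
      (x - (t - 0) * Function.rightLim (u t) x)) ?_ (fun _ _ => isOpen_Ioo) fun x hx => ?_
  · intro x _ x' _ hne
    refine Set.disjoint_left.2 fun b hb hb' => hne ?_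
    exact h.reaches_unique le_rfl ht.le ⟨hb.1.le, hb.2.le⟩ ⟨hb'.1.le, hb'.2.le⟩
  · rw [nonempty_Ioo]
    have : Function.rightLim (u t) x < Function.leftLim (u t) x := hx
    nlinarith

/-- Conservation of momentum: the mean velocity over a shock interval is the shock velocity. -/
theorem setIntegral_ubar_sub (h : IsPotential u U M) {s t : ℝ} (hs : 0 ≤ s) (hst : s < t) (x : ℝ) :
    ∫ b in Icc (x - (t - s) * Function.leftLim (u t) x) (x - (t - s) * Function.rightLim (u t) x),
      (ubar u s b - ubar u t x) = 0 := by
  have hle := h.lax t (hs.trans hst.le) x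
  have hab : x - (t - s) * Function.leftLim (u t) x ≤ x - (t - s) * Function.rightLim (u t) x := by
    nlinarith
  rw [integral_Icc_eq_integral_Ioc, ← intervalIntegral.integral_of_le hab,
    intervalIntegral.integral_sub (h.integral_ubar hs _ _).1 (by simp),
    (h.integral_ubar hs _ _).2, h.potential_sub_potential hs hst]
  rw [intervalIntegral.integral_const, smul_eq_mul, ubar]
  ring

/-- The velocity is transported along the flow as long as the curve has not entered a shock. -/
theorem ubar_eq_of_reaches (h : IsPotential u U M) {s t b x : ℝ} (hs : 0 ≤ s) (hst : s ≤ t)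
    (hx : Reaches u s b t x) (hsh : ¬ IsShock u t x) : ubar u s b = ubar u t x := by
  rcases hst.eq_or_lt with rfl | hst
  · rw [reaches_self_iff.1 hx]
  have heq : Function.leftLim (u t) x = Function.rightLim (u t) x :=
    le_antisymm (not_lt.1 hsh) (h.lax t (hs.trans hst.le) x)
  have hb : b = x - (t - s) * Function.rightLim (u t) x :=
    le_antisymm hx.2 (heq ▸ hx.1)
  have h1 := h.leftLim_eq_of_isFoot hs hst (h.isFoot_rightLim hs hst x)
  rw [sub_sub_cancel, mul_div_cancel_left₀ _ (by linarith), ← hb] at h1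
  rw [ubar, ubar, h1.1, h1.2, heq]

theorem formationTime_le (h : IsPotential u U M) {tf xf : ℝ} (htf : 0 < tf)
    (hshock : IsShock u tf xf) : formationTime u tf xf ≤ tf :=
  csInf_le ⟨0, fun _ ht => ht.1.1.le⟩
    ⟨⟨htf, le_rfl⟩, xf, hshock, (h.flowsTo_iff_reaches htf.le le_rfl).2 (reaches_self_iff.2 rfl)⟩

theorem not_isShock_of_lt_formationTime (h : IsPotential u U M) {tf xf t y : ℝ} (ht : 0 < t)
    (htt : t < formationTime u tf xf) (htf : t ≤ tf) (hy : Reaches u t y tf xf) :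
    ¬ IsShock u t y := fun hsh =>
  notMem_of_lt_csInf htt ⟨0, fun _ ht => ht.1.1.le⟩
    ⟨⟨ht, htf⟩, y, hsh, (h.flowsTo_iff_reaches ht.le htf).2 hy⟩

theorem shockInterval_eq (h : IsPotential u U M) {tf xf t : ℝ} (ht : 0 ≤ t) (htf : t ≤ tf) :
    shockInterval u tf xf t = Icc (xf - (tf - t) * Function.leftLim (u tf) xf)
      (xf - (tf - t) * Function.rightLim (u tf) xf) := by
  ext b
  exact h.flowsTo_iff_reaches ht htf

/-! ### The martingale property of the velocity process -/

section Martingale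

variable {Ω : Type*} [MeasurableSpace Ω] {P : Measure Ω} {X : ℝ → Ω → ℝ} {tf xf t₀ : ℝ}

theorem measurable_velocity (h : IsPotential u U M) (hX : IsGeometricProcess u tf xf t₀ P X) {t : ℝ}
    (ht : t ∈ Icc 0 tf) : Measurable (velocity u X t) :=
  (h.measurable_ubar ht.1).comp (hX.measurable t ht)

theorem integrable_velocity [IsProbabilityMeasure P] (h : IsPotential u U M)
    (hX : IsGeometricProcess u tf xf t₀ P X) {t : ℝ}
    (ht : t ∈ Icc 0 tf) : Integrable (velocity u X t) P :=
  Integrable.of_bound (h.measurable_velocity hX ht).aestronglyMeasurable M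
    (Eventually.of_forall fun w => h.abs_ubar_le ht.1 (X t w))

theorem reaches_process (h : IsPotential u U M) (hX : IsGeometricProcess u tf xf t₀ P X) {s t : ℝ}
    (hs : 0 ≤ s) (hst : s ≤ t) (ht : t ≤ tf) (w : Ω) : Reaches u s (X s w) t (X t w) :=
  h.reaches_of_isGenChar hs hst ((hX.isGenChar w).mono hs ht)

/-- Before the formation time the velocity process is almost surely constant. The curves which do
not end at `xf` may enter shocks earlier, hence the exceptional null set. -/
theorem velocity_ae_eq (h : IsPotential u U M) (hX : IsGeometricProcess u tf xf t₀ P X) {s t : ℝ}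
    (hs : 0 ≤ s) (hst : s ≤ t) (htf : t ≤ tf) (ht : t < formationTime u tf xf) :
    velocity u X s =ᵐ[P] velocity u X t := by
  filter_upwards [hX.final] with w hw
  rcases hst.eq_or_lt with rfl | hst
  · rfl
  have h1 := h.reaches_process hX (hs.trans hst.le) htf le_rfl w
  rw [hw] at h1
  exact h.ubar_eq_of_reaches hs hst.le (h.reaches_process hX hs hst.le htf w)
    (h.not_isShock_of_lt_formationTime (hs.trans_lt hst) ht htf h1)

/-- Over each fibre of the position at time `t`, the velocities at times `t₀` and `t` have the same
integral: the fibre is the event that the uniformly distributed position at time `t₀` lies in an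
interval between two extreme feet. -/
theorem setIntegral_fiber (h : IsPotential u U M) (hX : IsGeometricProcess u tf xf t₀ P X)
    (ht₀ : 0 ≤ t₀) {t : ℝ} (ht₀t : t₀ < t) (htf : t ≤ tf) (x : ℝ) :
    ∫ w in X t ⁻¹' {x}, (velocity u X t₀ w - velocity u X t w) ∂P = 0 := by
  have ht : t ∈ Icc 0 tf := ⟨ht₀.trans ht₀t.le, htf⟩
  have ht₀' : t₀ ∈ Icc 0 tf := ⟨ht₀, ht₀t.le.trans htf⟩
  by_cases hP : P (X t ⁻¹' {x}) = 0
  · exact setIntegral_measure_zero _ hP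
  set I := Icc (x - (t - t₀) * Function.leftLim (u t) x) (x - (t - t₀) * Function.rightLim (u t) x)
    with hI
  have hpre : X t ⁻¹' {x} = X t₀ ⁻¹' I := by
    ext w
    have hw := h.reaches_process hX ht₀ ht₀t.le htf w
    constructor
    · intro hwx
      rw [mem_preimage, mem_singleton_iff] at hwx
      rw [hwx] at hw
      exact hw
    · intro hwI
      exact h.reaches_unique ht₀ ht₀t.le hw hwI
  -- as the fibre is not negligible, its points flow to `xf`
  have hIB : I ⊆ shockInterval u tf xf t₀ := by
    obtain ⟨w, hw, hwf⟩ : ∃ w, X t w = x ∧ X tf w = xf := by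
      by_contra hcon
      push Not at hcon
      refine hP (measure_mono_null (fun w hw => ?_) hX.final)
      exact hcon w hw
    have h1 := h.reaches_process hX ht.1 htf le_rfl w
    rw [hw, hwf] at h1
    intro b hb
    exact (h.flowsTo_iff_reaches ht₀ ht₀'.2).2 (h.reaches_trans ht₀ ht₀t.le htf hb h1)
  have hg : Measurable fun b => ubar u t₀ b - ubar u t x := (h.measurable_ubar ht₀).sub_const _
  have h1 : ∫ w in X t ⁻¹' {x}, (velocity u X t₀ w - velocity u X t w) ∂P =
      ∫ w in X t₀ ⁻¹' I, (ubar u t₀ (X t₀ w) - ubar u t x) ∂P := by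
    rw [← hpre]
    refine setIntegral_congr_fun (hX.measurable t ht (measurableSet_singleton x)) fun w hw => ?_
    rw [mem_preimage, mem_singleton_iff] at hw
    simp only [velocity, hw]
  rw [h1, ← setIntegral_map (f := fun b => ubar u t₀ b - ubar u t x) measurableSet_Icc
    hg.aestronglyMeasurable (hX.measurable t₀ ht₀').aemeasurable]
  have hu : Measure.map (X t₀) P = _ := hX.uniform
  rw [hu, ProbabilityTheory.cond, Measure.restrict_smul,
    Measure.restrict_restrict measurableSet_Icc, inter_eq_self_of_subset_left hIB,
    integral_smul_measure, h.setIntegral_ubar_sub ht₀ ht₀t, smul_zero]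

/-- On every event that is determined by the position at time `t`, the velocities at the times `t₀`
and `t` have the same mean. -/
theorem setIntegral_velocity_eq [IsProbabilityMeasure P] (h : IsPotential u U M)
    (hX : IsGeometricProcess u tf xf t₀ P X)
    (ht₀ : 0 ≤ t₀) (ht₀' : t₀ < formationTime u tf xf) (ht₀tf : t₀ ≤ tf) {t : ℝ}
    (ht : t ∈ Icc 0 tf) {E : Set Ω} (hE : MeasurableSet E)
    (hsat : ∀ w w', X t w = X t w' → w ∈ E → w' ∈ E) :
    ∫ w in E, velocity u X t₀ w ∂P = ∫ w in E, velocity u X t w ∂P := by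
  rcases le_or_gt t t₀ with hle | hlt
  · refine setIntegral_congr_ae hE ?_
    filter_upwards [h.velocity_ae_eq hX ht.1 hle ht₀tf ht₀'] with w hw _ using hw.symm
  have hi₀ := (h.integrable_velocity hX ⟨ht₀, ht₀tf⟩)
  have hi := (h.integrable_velocity hX ht)
  rw [← sub_eq_zero, ← integral_sub hi₀.integrableOn hi.integrableOn]
  set S := {x | IsShock u t x} with hS
  have hSc : Countable S := (h.countable_isShock (ht₀.trans_lt hlt)).to_subtype
  have hmeas : ∀ x : ℝ, MeasurableSet (E ∩ X t ⁻¹' {x}) := fun x =>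
    hE.inter (hX.measurable t ht (measurableSet_singleton x))
  -- the velocity changes at shocks only
  have h1 : ∫ w in E, (velocity u X t₀ w - velocity u X t w) ∂P =
      ∫ w in ⋃ x : S, E ∩ X t ⁻¹' {x.1}, (velocity u X t₀ w - velocity u X t w) ∂P := by
    refine setIntegral_eq_of_subset_of_forall_sdiff_eq_zero hE
      (iUnion_subset fun x => inter_subset_left) fun w hw => ?_
    have hns : ¬ IsShock u t (X t w) := fun hsh =>
      hw.2 (mem_iUnion.2 ⟨⟨X t w, hsh⟩, hw.1, rfl⟩)
    exact sub_eq_zero.2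
      (h.ubar_eq_of_reaches ht₀ hlt.le (h.reaches_process hX ht₀ hlt.le ht.2 w) hns)
  rw [h1, integral_iUnion (f := fun w => velocity u X t₀ w - velocity u X t w)
    (fun x : S => hmeas x.1) ?_ (hi₀.sub hi).integrableOn]
  · refine (tsum_congr fun x => ?_).trans tsum_zero
    by_cases hx : ∃ w ∈ E, X t w = x
    · obtain ⟨w, hwE, hwx⟩ := hx
      have : E ∩ X t ⁻¹' {x.1} = X t ⁻¹' {x.1} :=
        inter_eq_self_of_subset_right fun w' hw' => hsat w w' (hwx.trans (Eq.symm hw')) hwE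
      rw [this]
      exact h.setIntegral_fiber hX ht₀ hlt ht.2 x
    · have : E ∩ X t ⁻¹' {x.1} = ∅ := by
        ext w
        simp only [mem_inter_iff, mem_preimage, mem_singleton_iff, mem_empty_iff_false, iff_false]
        exact fun hw => hx ⟨w, hw.1, hw.2⟩
      rw [this, setIntegral_empty]
  · intro x x' hne
    refine Set.disjoint_left.2 fun w hw hw' => hne (Subtype.ext ?_)
    exact (Eq.symm hw.2).trans hw'.2

/-- The backward martingale property. An event given by the velocity at time `s` is determined by
the position at time `s`, and, as the flow is deterministic, also by the position at the earlier
time `t`. -/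
theorem condExp_velocity [IsProbabilityMeasure P] (h : IsPotential u U M)
    (hX : IsGeometricProcess u tf xf t₀ P X)
    (ht₀ : 0 ≤ t₀) (ht₀' : t₀ < formationTime u tf xf) (ht₀tf : t₀ ≤ tf) {s t : ℝ}
    (ht : t ∈ Icc 0 tf) (hs : s ∈ Icc 0 tf) (hts : t ≤ s) :
    P[velocity u X t | MeasurableSpace.comap (velocity u X s) inferInstance]
      =ᵐ[P] velocity u X s := by
  have hm : MeasurableSpace.comap (velocity u X s) inferInstance ≤ _ :=
    (h.measurable_velocity hX hs).comap_le
  symm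
  refine ae_eq_condExp_of_forall_setIntegral_eq hm (h.integrable_velocity hX ht)
    (fun _ _ _ => (h.integrable_velocity hX hs).integrableOn) ?_
    (comap_measurable _).aestronglyMeasurable
  intro E hE _
  have hE' : MeasurableSet E := hm _ hE
  obtain ⟨A, -, rfl⟩ := hE
  rw [← h.setIntegral_velocity_eq hX ht₀ ht₀' ht₀tf hs hE',
    ← h.setIntegral_velocity_eq hX ht₀ ht₀' ht₀tf ht hE']
  · intro w w' hww' hw
    have h1 := h.reaches_process hX ht.1 hts hs.2 w
    have h2 := h.reaches_process hX ht.1 hts hs.2 w'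
    rw [← hww'] at h2
    rw [mem_preimage, velocity] at hw ⊢
    rwa [← h.reaches_unique ht.1 hts h1 h2]
  · intro w w' hww' hw
    rw [mem_preimage, velocity] at hw ⊢
    rwa [← hww']

end Martingale

/-- Existence: a uniformly distributed point of the shock interval at time `t₀` is traced back to
time `0` with the velocity `ū`, which stays between the extreme backward characteristics, and then
follows the forward flow. -/
theorem exists_geometric_process (h : IsPotential u U M) {tf xf t₀ : ℝ} (hshock : IsShock u tf xf)
    (ht₀ : 0 ≤ t₀) (htf : t₀ < tf) :
    ∃ (P : Measure ℝ) (X : ℝ → ℝ → ℝ),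
      IsProbabilityMeasure P ∧ IsGeometricProcess u tf xf t₀ P X := by
  have hex : ∀ t b, ∃ x, 0 ≤ t → Reaches u 0 b t x := fun t b => by
    by_cases ht : 0 ≤ t
    · obtain ⟨x, hx⟩ := h.exists_reaches le_rfl ht b
      exact ⟨x, fun _ => hx⟩
    · exact ⟨0, fun h' => absurd h' ht⟩
  choose F hF using hex
  have hFmono : ∀ t, 0 ≤ t → Monotone (F t) := fun t ht b b' hb =>
    h.le_of_reaches le_rfl ht hb (hF t b ht) (hF t b' ht)
  -- the initial position of a characteristic through `(t₀, w)`
  set b₀ : ℝ → ℝ := fun w => w - t₀ * ubar u t₀ w with hb₀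
  have hb₀m : Measurable b₀ := measurable_id.sub ((h.measurable_ubar ht₀).const_mul t₀)
  have hreach : ∀ w, Reaches u 0 (b₀ w) t₀ w := fun w => by
    have := h.lax t₀ ht₀ w
    constructor <;> simp only [hb₀, ubar] <;> nlinarith
  have hFt₀ : ∀ w, F t₀ (b₀ w) = w := fun w =>
    h.reaches_unique le_rfl ht₀ (hF t₀ _ ht₀) (hreach w)
  have hB := h.shockInterval_eq (xf := xf) ht₀ htf.le
  have hlt : Function.rightLim (u tf) xf < Function.leftLim (u tf) xf := hshock
  have hvol : volume (shockInterval u tf xf t₀) ≠ 0 := by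
    rw [hB, Real.volume_Icc]
    simp only [ne_eq, ENNReal.ofReal_eq_zero, not_le]
    nlinarith
  have hvol' : volume (shockInterval u tf xf t₀) ≠ ⊤ := by
    rw [hB, Real.volume_Icc]
    exact ENNReal.ofReal_ne_top
  refine ⟨ProbabilityTheory.cond volume (shockInterval u tf xf t₀), fun t w => F t (b₀ w),
    cond_isProbabilityMeasure_of_finite hvol hvol', ?_, ?_, ?_, ?_⟩
  · exact fun t ht => (hFmono t ht.1).measurable.comp hb₀m
  · exact fun w => h.isGenChar_of_reaches le_rfl fun r hr => hF r _ hr.1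
  · have hmeas : MeasurableSet (shockInterval u tf xf t₀) := hB ▸ measurableSet_Icc
    filter_upwards [ae_cond_mem hmeas] with w hw
    exact h.reaches_unique le_rfl (ht₀.trans htf.le) (hF tf _ (ht₀.trans htf.le))
      (h.reaches_trans le_rfl ht₀ htf.le (hreach w) ((h.flowsTo_iff_reaches ht₀ htf.le).1 hw))
  · simp only [pdf.IsUniform, hFt₀]
    exact Measure.map_id'

end IsPotential

/-! ### Test functions and functions of bounded variation -/

theorem exists_tsupport_subset_Ioc {θ : ℝ → ℝ} (hs : HasCompactSupport θ) :
    ∃ N : ℝ, 0 < N ∧ tsupport θ ⊆ Ioc (-N) N := by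
  obtain ⟨R, hR⟩ := hs.isCompact.isBounded.subset_closedBall (0 : ℝ)
  refine ⟨|R| + 1, by positivity, hR.trans fun x hx => ?_⟩
  rw [Metric.mem_closedBall, Real.dist_eq, sub_zero] at hx
  have := abs_le.1 (hx.trans (le_abs_self R))
  constructor <;> linarith

/-- Integration by parts against a primitive. -/
theorem integral_primitive_mul_deriv {f θ : ℝ → ℝ} (hf : LocallyIntegrable f)
    (hθ : ContDiff ℝ ∞ θ) (hs : HasCompactSupport θ) :
    ∫ x, (∫ z in (0 : ℝ)..x, f z) * deriv θ x = -∫ x, f x * θ x := by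
  obtain ⟨N, hN, hsub⟩ := exists_tsupport_subset_Ioc hs
  have hs1 : Function.support θ ⊆ Ioc (-N) N := (subset_tsupport θ).trans hsub
  have hs2 : Function.support (deriv θ) ⊆ Ioc (-N) N := (support_deriv_subset).trans hsub
  have hint : IntervalIntegrable f volume (-N) N :=
    (hf.integrableOn_isCompact isCompact_uIcc).intervalIntegrable
  have h0 : (0 : ℝ) ∈ uIcc (-N) N := by
    rw [uIcc_of_le (by linarith)]; constructor <;> linarith
  have hac1 := hint.absolutelyContinuousOnInterval_intervalIntegral h0
  have hac2 : AbsolutelyContinuousOnInterval θ (-N) N :=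
    (hθ.of_le (by simp)).contDiffOn.absolutelyContinuousOnInterval
  have hθN : θ N = 0 ∧ θ (-N) = 0 := by
    have hc : Continuous θ := hθ.continuous
    have hd : deriv θ (-N) = 0 ∧ θ (-N) = 0 := by
      constructor
      · by_contra hne; exact absurd (hs2 hne).1 (lt_irrefl _)
      · by_contra hne; exact absurd (hs1 hne).1 (lt_irrefl _)
    refine ⟨?_, hd.2⟩
    -- `θ` vanishes on `(N, ∞)`
    have h1 : Tendsto θ (𝓝[>] N) (𝓝 (θ N)) := hc.continuousAt.continuousWithinAt
    refine tendsto_nhds_unique h1 (tendsto_const_nhds.congr' ?_)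
    filter_upwards [self_mem_nhdsWithin] with x hx
    by_contra hne
    exact absurd (hs1 (Ne.symm hne)).2 (not_le.2 hx)
  have hae : ∫ x in (-N)..N, deriv (fun x => ∫ z in (0 : ℝ)..x, f z) x * θ x =
      ∫ x in (-N)..N, f x * θ x := by
    refine intervalIntegral.integral_congr_ae ?_
    filter_upwards [LocallyIntegrable.ae_hasDerivAt_integral hf] with x hx _
    rw [(hx 0).deriv]
  rw [← intervalIntegral.integral_eq_integral_of_support_subset (a := -N) (b := N)
      ((Function.support_mul_subset_right _ _).trans hs2),
    ← intervalIntegral.integral_eq_integral_of_support_subset (a := -N) (b := N)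
      ((Function.support_mul_subset_right _ _).trans hs1),
    hac1.integral_mul_deriv_eq_deriv_mul hac2, hae, hθN.1, hθN.2]
  ring

/-- The lemma of du Bois-Reymond. -/
theorem ae_eq_const_of_integral_mul_deriv_eq_zero {F : ℝ → ℝ} (hF : LocallyIntegrable F)
    (h : ∀ θ : ℝ → ℝ, ContDiff ℝ ∞ θ → HasCompactSupport θ → ∫ x, F x * deriv θ x = 0) :
    ∃ c, ∀ᵐ x, F x = c := by
  set η : ℝ → ℝ := (default : ContDiffBump (0 : ℝ)).normed volume with hη
  have hη1 : ContDiff ℝ ∞ η := ContDiffBump.contDiff_normed _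
  have hη2 : HasCompactSupport η := ContDiffBump.hasCompactSupport_normed _
  have hη3 : ∫ x, η x = 1 := ContDiffBump.integral_normed _
  have hint : ∀ g : ℝ → ℝ, ContDiff ℝ ∞ g → HasCompactSupport g →
      Integrable (fun x => F x * g x) := fun g hg hgs => by
    simpa [mul_comm, smul_eq_mul] using
      hF.integrable_smul_left_of_hasCompactSupport hg.continuous hgs
  refine ⟨∫ x, F x * η x, ae_eq_of_integral_contDiff_smul_eq hF (locallyIntegrable_const _)
    fun g hg hgs => ?_⟩
  -- `g - (∫ g) • η` has mean zero and is therefore the derivative of a test function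
  set κ : ℝ → ℝ := fun x => g x - (∫ y, g y) * η x with hκ
  have hκ1 : ContDiff ℝ ∞ κ := hg.sub (contDiff_const.mul hη1)
  have hκ2 : HasCompactSupport κ := hgs.sub (hη2.mul_left)
  have hκ3 : ∫ x, κ x = 0 := by
    rw [hκ, integral_sub (hg.continuous.integrable_of_hasCompactSupport hgs)
      ((hη1.continuous.integrable_of_hasCompactSupport hη2).const_mul _),
      integral_const_mul, hη3]
    ring
  obtain ⟨N, hN, hsub⟩ := exists_tsupport_subset_Ioc hκ2
  set χ : ℝ → ℝ := fun x => ∫ z in (-N)..x, κ z with hχ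
  have hχd : ∀ x, HasDerivAt χ (κ x) x := fun x =>
    intervalIntegral.integral_hasDerivAt_right (hκ1.continuous.intervalIntegrable _ _)
      hκ1.continuous.stronglyMeasurable.stronglyMeasurableAtFilter hκ1.continuous.continuousAt
  have hχ' : deriv χ = κ := funext fun x => (hχd x).deriv
  have hχ1 : ContDiff ℝ ∞ χ :=
    contDiff_infty_iff_deriv.2 ⟨fun x => (hχd x).differentiableAt, hχ' ▸ hκ1⟩
  have hzero : ∀ x, x ∉ Ioc (-N) N → κ x = 0 := fun x hx => by
    by_contra hne; exact hx (hsub (subset_tsupport κ hne))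
  have hχ2 : HasCompactSupport χ := by
    refine HasCompactSupport.intro (isCompact_Icc (a := -N) (b := N)) fun x hx => ?_
    rcases lt_or_ge x (-N) with hlt | hge
    · rw [hχ]
      refine intervalIntegral.integral_zero_ae (Eventually.of_forall fun z hz => hzero z ?_)
      rw [uIoc_of_ge hlt.le] at hz
      exact fun hz' => absurd hz.2 (not_le.2 hz'.1)
    · have hNx : N < x := by
        by_contra hle; exact hx ⟨hge, not_lt.1 hle⟩
      rw [hχ]
      simp only
      rw [intervalIntegral.integral_eq_integral_of_support_subset, hκ3]
      exact ((subset_tsupport κ).trans hsub).trans (Ioc_subset_Ioc_right hNx.le)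
  have h1 := h χ hχ1 hχ2
  rw [hχ'] at h1
  have h2 : ∫ x, F x * κ x = (∫ x, F x * g x) - (∫ y, g y) * ∫ x, F x * η x := by
    rw [← integral_const_mul, ← integral_sub (hint g hg hgs) ((hint η hη1 hη2).const_mul _)]
    congr 1
    ext x
    simp only [hκ]
    ring
  rw [h2, sub_eq_zero] at h1
  simp only [smul_eq_mul, integral_mul_const]
  rw [← h1]
  congr 1
  ext x
  ring

theorem LocallyBoundedVariationOn.measurable_and_tendsto {f : ℝ → ℝ}
    (hf : LocallyBoundedVariationOn f univ) :
    Measurable f ∧ (∀ x, Tendsto f (𝓝[<] x) (𝓝 (Function.leftLim f x))) ∧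
      ∀ x, Tendsto f (𝓝[>] x) (𝓝 (Function.rightLim f x)) := by
  obtain ⟨p, q, hp, hq, rfl⟩ := hf.exists_monotoneOn_sub_monotoneOn
  rw [monotoneOn_univ] at hp hq
  refine ⟨hp.measurable.sub hq.measurable, fun x => ?_, fun x => ?_⟩
  · exact tendsto_leftLim_of_tendsto ⟨_, (hp.tendsto_leftLim x).sub (hq.tendsto_leftLim x)⟩
  · exact tendsto_rightLim_of_tendsto ⟨_, (hp.tendsto_rightLim x).sub (hq.tendsto_rightLim x)⟩

/-! ### The potential of an entropy solution -/

theorem abs_sq_sub_sq_le {M a b : ℝ} (ha : |a| ≤ M) (hb : |b| ≤ M) :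
    |a ^ 2 - b ^ 2| ≤ 2 * M * |a - b| := by
  rw [sq_sub_sq, abs_mul]
  exact mul_le_mul_of_nonneg_right ((abs_add_le a b).trans (by linarith)) (abs_nonneg _)

namespace IsEntropySolution

variable {u : ℝ → ℝ → ℝ} {M : ℝ}

theorem measurable (hu : IsEntropySolution u) {t : ℝ} (ht : 0 ≤ t) : Measurable (u t) :=
  (hu.boundedVariation t ht).measurable_and_tendsto.1

/-- Continuity in `L¹_loc` is inherited by the Lipschitz nonlinearities of the solution, tested with
a bounded function of compact support. -/
theorem continuousOn_integral_comp (hu : IsEntropySolution u)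
    (hM : ∀ t, 0 ≤ t → ∀ x, |u t x| ≤ M) {G χ : ℝ → ℝ} {L C R : ℝ} (hG : Measurable G)
    (hL : ∀ a b, |a| ≤ M → |b| ≤ M → |G a - G b| ≤ L * |a - b|) (hχ : Measurable χ)
    (hC : ∀ x, |χ x| ≤ C) (hR : ∀ x, x ∉ Icc (-R) R → χ x = 0) :
    ContinuousOn (fun t => ∫ x, G (u t x) * χ x) (Ici 0) := by
  have hM0 : 0 ≤ M := (abs_nonneg _).trans (hM 0 le_rfl 0)
  have hC0 : 0 ≤ C := (abs_nonneg _).trans (hC 0)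
  have hbd : ∀ t, 0 ≤ t → ∀ x, |G (u t x)| ≤ L * |u t x - 0| + |G 0| := fun t ht x => by
    have h1 := hL (u t x) 0 (hM t ht x) (by simpa using hM0)
    have h2 := abs_sub_abs_le_abs_sub (G (u t x)) (G 0)
    linarith
  have hcompact : volume (Icc (-R) R) ≠ ⊤ := by rw [Real.volume_Icc]; exact ENNReal.ofReal_ne_top
  have hint0 : ∀ t, 0 ≤ t → IntegrableOn (u t) (Icc (-R) R) := fun t ht =>
    Measure.integrableOn_of_bounded (M := M) hcompact (hu.measurable ht).aestronglyMeasurable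
      (Eventually.of_forall fun x => hM t ht x)
  have hint : ∀ t, 0 ≤ t → IntegrableOn (fun x => G (u t x) * χ x) (Icc (-R) R) := fun t ht => by
    have h1 : IntegrableOn (fun x => G (u t x)) (Icc (-R) R) := by
      refine Integrable.mono' (((hint0 t ht).sub (integrable_const 0)).abs.const_mul L |>.add
        (integrable_const |G 0|)) (hG.comp (hu.measurable ht)).aestronglyMeasurable
        (Eventually.of_forall fun x => ?_)
      simpa using hbd t ht x
    refine Integrable.mono' (h1.abs.const_mul C)
      ((hG.comp (hu.measurable ht)).mul hχ).aestronglyMeasurable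
      (Eventually.of_forall fun x => ?_)
    rw [Real.norm_eq_abs, abs_mul, mul_comm]
    exact mul_le_mul_of_nonneg_right (hC x) (abs_nonneg _)
  have heq : ∀ t, ∫ x, G (u t x) * χ x = ∫ x in Icc (-R) R, G (u t x) * χ x := fun t =>
    (setIntegral_eq_integral_of_forall_compl_eq_zero fun x hx => by rw [hR x hx, mul_zero]).symm
  intro t ht
  have ht0 : 0 ≤ t := ht
  rw [ContinuousWithinAt, tendsto_iff_dist_tendsto_zero]
  have hlim := (hu.continuous_L1loc t ht0 R).const_mul (C * L)
  rw [mul_zero] at hlim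
  refine squeeze_zero' (Eventually.of_forall fun _ => dist_nonneg) ?_ hlim
  filter_upwards [self_mem_nhdsWithin] with s hs
  have hs0 : 0 ≤ s := hs
  rw [Real.dist_eq, heq s, heq t, ← integral_sub (hint s hs0) (hint t ht0), ← integral_const_mul]
  refine (abs_integral_le_integral_abs).trans (integral_mono
    ((hint s hs0).sub (hint t ht0)).abs (((hint0 s hs0).sub (hint0 t ht0)).abs.const_mul _)
    fun x => ?_)
  simp only
  rw [← sub_mul, abs_mul, mul_assoc, mul_comm C]
  exact mul_le_mul (hL _ _ (hM s hs0 x) (hM t ht0 x)) (hC x) (abs_nonneg _)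
    ((abs_nonneg _).trans (hL _ _ (hM s hs0 x) (hM t ht0 x)))

theorem continuousOn_integral_test (hu : IsEntropySolution u)
    (hM : ∀ t, 0 ≤ t → ∀ x, |u t x| ≤ M) {χ : ℝ → ℝ} (hχ : Continuous χ)
    (hs : HasCompactSupport χ) :
    ContinuousOn (fun t => ∫ x, u t x * χ x) (Ici 0) ∧
      ContinuousOn (fun t => ∫ x, u t x ^ 2 / 2 * χ x) (Ici 0) := by
  obtain ⟨C, hC⟩ := hχ.bounded_above_of_compact_support hs
  obtain ⟨N, hN, hsub⟩ := exists_tsupport_subset_Ioc hs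
  have hR : ∀ x, x ∉ Icc (-N) N → χ x = 0 := fun x hx => by
    by_contra hne
    exact hx (Ioc_subset_Icc_self (hsub (subset_tsupport χ hne)))
  refine ⟨hu.continuousOn_integral_comp hM (G := fun a => a) (L := 1) measurable_id
    (fun a b _ _ => by rw [one_mul]) hχ.measurable hC hR,
    hu.continuousOn_integral_comp hM (G := fun a => a ^ 2 / 2) (L := M)
    (by fun_prop) (fun a b ha hb => ?_) hχ.measurable hC hR⟩
  have := abs_sq_sub_sq_le ha hb
  rw [← sub_div, abs_div, abs_two]
  linarith

theorem continuousOn_intervalIntegral_sq (hu : IsEntropySolution u)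
    (hM : ∀ t, 0 ≤ t → ∀ x, |u t x| ≤ M) (a b : ℝ) :
    ContinuousOn (fun t => ∫ x in a..b, u t x ^ 2) (Ici 0) := by
  have key : ∀ a b : ℝ, ContinuousOn (fun t => ∫ x in Ioc a b, u t x ^ 2) (Ici 0) := by
    intro a b
    have h1 := hu.continuousOn_integral_comp hM (G := fun a => a ^ 2)
      (χ := (Ioc a b).indicator fun _ => (1 : ℝ)) (L := 2 * M) (C := 1) (R := max |a| |b|)
      (by fun_prop) (fun a b ha hb => abs_sq_sub_sq_le ha hb)
      (measurable_const.indicator measurableSet_Ioc) (fun x => ?_) (fun x hx => ?_)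
    · refine h1.congr fun t _ => ?_
      rw [← integral_indicator measurableSet_Ioc]
      congr 1
      ext x
      by_cases hx : x ∈ Ioc a b <;> simp [hx]
    · by_cases hx : x ∈ Ioc a b <;> simp [hx]
    · refine indicator_of_notMem (fun hx' => hx ⟨?_, ?_⟩) _
      · have := neg_abs_le a
        have := le_max_left |a| |b|
        linarith [hx'.1]
      · have := le_abs_self b
        have := le_max_right |a| |b|
        linarith [hx'.2]
  exact (key a b).sub (key b a)

theorem aestronglyMeasurable_prod (hu : IsEntropySolution u) {t : ℝ} :
    AEStronglyMeasurable (fun p : ℝ × ℝ => u p.1 p.2)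
      ((volume.restrict (Ioc 0 t)).prod volume) := by
  refine hu.aestronglyMeasurable.mono_measure ?_
  rw [Measure.volume_eq_prod, ← Measure.prod_restrict, Measure.restrict_univ,
    ← Measure.restrict_univ (μ := (volume : Measure ℝ)), Measure.prod_restrict,
    Measure.prod_restrict]
  exact Measure.restrict_mono (prod_mono_left Ioc_subset_Ioi_self) le_rfl

/-- The weak formulation for the test function `θ t * χ x`. -/
theorem weak_mul (hu : IsEntropySolution u) (hM : ∀ t, 0 ≤ t → ∀ x, |u t x| ≤ M) {θ χ : ℝ → ℝ}
    (hθ : ContDiff ℝ ∞ θ) (hθs : HasCompactSupport θ) (hχ : ContDiff ℝ ∞ χ)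
    (hχs : HasCompactSupport χ) :
    (∫ t in Ioi (0 : ℝ), ((∫ x, u t x * χ x) * deriv θ t +
      (∫ x, u t x ^ 2 / 2 * deriv χ x) * θ t)) + (∫ x, u 0 x * χ x) * θ 0 = 0 := by
  have hM0 : 0 ≤ M := (abs_nonneg _).trans (hM 0 le_rfl 0)
  have hφ1 : ContDiff ℝ ∞ (fun p : ℝ × ℝ => θ p.1 * χ p.2) :=
    (hθ.comp contDiff_fst).mul (hχ.comp contDiff_snd)
  have hφ2 : HasCompactSupport (fun p : ℝ × ℝ => θ p.1 * χ p.2) := by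
    refine HasCompactSupport.intro (hθs.isCompact.prod hχs.isCompact) fun p hp => ?_
    rw [mem_prod, not_and_or] at hp
    rcases hp with hp | hp
    · rw [image_eq_zero_of_notMem_tsupport hp, zero_mul]
    · rw [image_eq_zero_of_notMem_tsupport hp, mul_zero]
  have hd : ∀ p : ℝ × ℝ, fderiv ℝ (fun p : ℝ × ℝ => θ p.1 * χ p.2) p (1, 0) =
      deriv θ p.1 * χ p.2 ∧ fderiv ℝ (fun p : ℝ × ℝ => θ p.1 * χ p.2) p (0, 1) =
      θ p.1 * deriv χ p.2 := by
    intro p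
    have h1 : HasFDerivAt (fun p : ℝ × ℝ => θ p.1)
        (deriv θ p.1 • ContinuousLinearMap.fst ℝ ℝ ℝ) p :=
      (hθ.differentiable (by simp) p.1).hasDerivAt.comp_hasFDerivAt p hasFDerivAt_fst
    have h2 : HasFDerivAt (fun p : ℝ × ℝ => χ p.2)
        (deriv χ p.2 • ContinuousLinearMap.snd ℝ ℝ ℝ) p :=
      (hχ.differentiable (by simp) p.2).hasDerivAt.comp_hasFDerivAt p hasFDerivAt_snd
    have h3 : HasFDerivAt (fun p : ℝ × ℝ => θ p.1 * χ p.2) _ p := h1.mul h2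
    rw [h3.fderiv]
    constructor <;> simp [mul_comm]
  have hw := hu.weak _ hφ1 hφ2
  simp only [(hd _).1, (hd _).2] at hw
  have hc1 : Continuous (deriv θ) := hθ.continuous_deriv (by simp)
  have hc2 : Continuous (deriv χ) := hχ.continuous_deriv (by simp)
  have hprod : ∀ a b : ℝ → ℝ, Continuous a → HasCompactSupport a → Continuous b →
      HasCompactSupport b → Integrable (fun p : ℝ × ℝ => a p.1 * b p.2) :=
    fun a b ha has hb hbs => by
    rw [Measure.volume_eq_prod]
    exact (ha.integrable_of_hasCompactSupport has).mul_prod (hb.integrable_of_hasCompactSupport hbs)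
  have hi1 : IntegrableOn (fun p : ℝ × ℝ => u p.1 p.2 * (deriv θ p.1 * χ p.2))
      (Ioi (0 : ℝ) ×ˢ univ) := by
    refine Integrable.mono' ((hprod _ _ hc1 hθs.deriv hχ.continuous hχs).abs.const_mul
      M).integrableOn (hu.aestronglyMeasurable.mul (Continuous.aestronglyMeasurable (by
        have := hχ.continuous; fun_prop))) ?_
    refine (ae_restrict_mem (measurableSet_Ioi.prod MeasurableSet.univ)).mono fun p hp => ?_
    rw [Real.norm_eq_abs, abs_mul]
    exact mul_le_mul_of_nonneg_right (hM _ (le_of_lt hp.1) _) (abs_nonneg _)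
  have hi2 : IntegrableOn (fun p : ℝ × ℝ => u p.1 p.2 ^ 2 / 2 * (θ p.1 * deriv χ p.2))
      (Ioi (0 : ℝ) ×ˢ univ) := by
    refine Integrable.mono' ((hprod _ _ hθ.continuous hθs hc2 hχs.deriv).abs.const_mul
      (M ^ 2)).integrableOn (((hu.aestronglyMeasurable.pow 2).mul
        (aestronglyMeasurable_const (b := (1 / 2 : ℝ)))).congr (Eventually.of_forall fun p => ?_)
        |>.mul (Continuous.aestronglyMeasurable (by have := hθ.continuous; fun_prop))) ?_
    · simp only [Pi.mul_apply, Pi.pow_apply]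
      ring
    refine (ae_restrict_mem (measurableSet_Ioi.prod MeasurableSet.univ)).mono fun p hp => ?_
    rw [Real.norm_eq_abs, abs_mul]
    refine mul_le_mul_of_nonneg_right ?_ (abs_nonneg _)
    have h1 := sq_le_sq.2 ((hM _ (le_of_lt hp.1) p.2).trans (le_abs_self M))
    rw [abs_of_nonneg (by positivity)]
    nlinarith [sq_nonneg (u p.1 p.2)]
  have hi := hi1.add hi2
  rw [Measure.volume_eq_prod] at hw hi
  have hsp := setIntegral_prod _ hi
  simp only [Pi.add_apply] at hsp
  rw [hsp] at hw
  refine Eq.trans ?_ hw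
  congr 1
  · refine setIntegral_congr_fun measurableSet_Ioi fun t ht => ?_
    have ht0 : 0 ≤ t := le_of_lt ht
    have hb : ∀ b : ℝ → ℝ, Continuous b → HasCompactSupport b →
        Integrable (fun x => u t x * b x) ∧ Integrable (fun x => u t x ^ 2 / 2 * b x) := by
      intro b hbc hbs
      constructor
      · refine (hbc.integrable_of_hasCompactSupport hbs).bdd_mul
          (hu.measurable ht0).aestronglyMeasurable (c := M)
          (Eventually.of_forall fun x => hM t ht0 x)
      · refine (hbc.integrable_of_hasCompactSupport hbs).bdd_mul (c := M ^ 2)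
          (((hu.measurable ht0).pow_const 2).div_const 2).aestronglyMeasurable
          (Eventually.of_forall fun x => ?_)
        have h1 := sq_le_sq.2 ((hM _ ht0 x).trans (le_abs_self M))
        rw [Real.norm_eq_abs, abs_of_nonneg (by positivity)]
        nlinarith [sq_nonneg (u t x)]
    simp only [Measure.restrict_univ]
    rw [← integral_mul_const, ← integral_mul_const, ← integral_add
      ((hb χ hχ.continuous hχs).1.mul_const _) ((hb _ hc2 hχs.deriv).2.mul_const _)]
    congr 1
    ext x
    ring
  · rw [← integral_mul_const]
    congr 1
    ext x
    ring

/-- The balance law tested against a function of space. -/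
theorem integral_mul_sub (hu : IsEntropySolution u) (hM : ∀ t, 0 ≤ t → ∀ x, |u t x| ≤ M)
    {χ : ℝ → ℝ} (hχ : ContDiff ℝ ∞ χ) (hχs : HasCompactSupport χ) {t : ℝ} (ht : 0 ≤ t) :
    (∫ x, u t x * χ x) - ∫ x, u 0 x * χ x =
      ∫ τ in (0 : ℝ)..t, ∫ x, u τ x ^ 2 / 2 * deriv χ x := by
  set g : ℝ → ℝ := fun t => ∫ x, u t x * χ x with hg
  set k : ℝ → ℝ := fun t => ∫ x, u t x ^ 2 / 2 * deriv χ x with hk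
  have hgc : ContinuousOn g (Ici 0) := (hu.continuousOn_integral_test hM hχ.continuous hχs).1
  have hkc : ContinuousOn k (Ici 0) :=
    (hu.continuousOn_integral_test hM (hχ.continuous_deriv (by simp)) hχs.deriv).2
  have hgc' : Continuous fun t => g (max t 0) :=
    hgc.comp_continuous (by fun_prop) fun t => le_max_right t 0
  have hkc' : Continuous fun t => k (max t 0) :=
    hkc.comp_continuous (by fun_prop) fun t => le_max_right t 0
  -- extend by `g 0` and by `0` to negative times
  set k₀ : ℝ → ℝ := (Ioi (0 : ℝ)).indicator fun t => k (max t 0) with hk₀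
  have hk₀i : LocallyIntegrable k₀ := hkc'.locallyIntegrable.indicator measurableSet_Ioi
  have hKc : Continuous fun t => ∫ τ in (0 : ℝ)..t, k₀ τ :=
    intervalIntegral.continuous_primitive
      (fun a b => (hk₀i.integrableOn_isCompact isCompact_uIcc).intervalIntegrable) 0
  have hFc : Continuous fun t => g (max t 0) - ∫ τ in (0 : ℝ)..t, k₀ τ := hgc'.sub hKc
  obtain ⟨c, hc⟩ := ae_eq_const_of_integral_mul_deriv_eq_zero hFc.locallyIntegrable
    fun θ hθ hθs => by
      have hθc : Continuous (deriv θ) := hθ.continuous_deriv (by simp)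
      have hi : ∀ f : ℝ → ℝ, Continuous f → Integrable fun t => f t * deriv θ t := fun f hf =>
        (hf.mul hθc).integrable_of_hasCompactSupport hθs.deriv.mul_left
      have hi' : ∀ f : ℝ → ℝ, Continuous f → Integrable fun t => f t * θ t := fun f hf =>
        (hf.mul hθ.continuous).integrable_of_hasCompactSupport hθs.mul_left
      have h1 : ∫ t, g (max t 0) * deriv θ t = g 0 * θ 0 + ∫ t in Ioi (0 : ℝ), g t * deriv θ t := by
        rw [← intervalIntegral.integral_Iic_add_Ioi (b := 0) (hi _ hgc').integrableOn
          (hi _ hgc').integrableOn]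
        congr 1
        · rw [← hθs.integral_Iic_deriv_eq (hθ.of_le (by simp)) 0, ← integral_const_mul]
          refine setIntegral_congr_fun measurableSet_Iic fun t ht => ?_
          have ht' : t ≤ 0 := ht
          simp only [max_eq_right ht']
        · refine setIntegral_congr_fun measurableSet_Ioi fun t ht => ?_
          have ht' : 0 ≤ t := (mem_Ioi.1 ht).le
          simp only [max_eq_left ht']
      have h2 : ∫ t, k₀ t * θ t = ∫ t in Ioi (0 : ℝ), k t * θ t := by
        rw [← integral_indicator measurableSet_Ioi]
        congr 1
        ext t
        by_cases ht : t ∈ Ioi (0 : ℝ)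
        · rw [hk₀, indicator_of_mem ht, indicator_of_mem ht, max_eq_left (le_of_lt ht)]
        · rw [hk₀, indicator_of_notMem ht, indicator_of_notMem ht, zero_mul]
      have h3 := integral_primitive_mul_deriv hk₀i hθ hθs
      have h4 := hu.weak_mul hM hθ hθs hχ hχs
      have hi1 : IntegrableOn (fun t => g t * deriv θ t) (Ioi 0) :=
        (hi _ hgc').integrableOn.congr_fun (fun t ht => by
          have ht' : 0 ≤ t := (mem_Ioi.1 ht).le
          simp only [max_eq_left ht']) measurableSet_Ioi
      have hi2 : IntegrableOn (fun t => k t * θ t) (Ioi 0) :=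
        (hi' _ hkc').integrableOn.congr_fun (fun t ht => by
          have ht' : 0 ≤ t := (mem_Ioi.1 ht).le
          simp only [max_eq_left ht']) measurableSet_Ioi
      rw [integral_add hi1 hi2] at h4
      simp only [sub_mul]
      rw [integral_sub (hi _ hgc') (hi _ hKc), h1, h3, h2]
      linarith
  have hFeq := (hFc.ae_eq_iff_eq (continuous_const (y := c)) (μ := volume)).1 hc
  have ht' := congrFun hFeq t
  have h0' := congrFun hFeq 0
  simp only [max_self, intervalIntegral.integral_same, max_eq_left ht] at ht' h0'
  have hkk : ∫ τ in (0 : ℝ)..t, k₀ τ = ∫ τ in (0 : ℝ)..t, k τ := by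
    refine intervalIntegral.integral_congr_ae (Eventually.of_forall fun τ hτ => ?_)
    rw [uIoc_of_le ht] at hτ
    rw [hk₀, indicator_of_mem (show τ ∈ Ioi (0 : ℝ) from hτ.1), max_eq_left hτ.1.le]
  rw [hkk] at ht'
  linarith

theorem integrable_sq_mul (hu : IsEntropySolution u) (hM : ∀ t, 0 ≤ t → ∀ x, |u t x| ≤ M)
    {t : ℝ} {b : ℝ → ℝ} (hb : Integrable b) :
    Integrable (Function.uncurry fun τ x => u τ x ^ 2 / 2 * b x)
      ((volume.restrict (Ioc 0 t)).prod volume) := by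
  have h1 : Integrable (fun p : ℝ × ℝ => (1 : ℝ) * b p.2)
      ((volume.restrict (Ioc 0 t)).prod volume) :=
    (integrable_const (1 : ℝ)).mul_prod hb
  refine Integrable.mono' (h1.abs.const_mul (M ^ 2)) ?_ ?_
  · have h2 := (hu.aestronglyMeasurable_prod (t := t)).pow 2
    refine ((h2.mul (aestronglyMeasurable_const (b := (1 / 2 : ℝ)))).mul
      h1.aestronglyMeasurable).congr (Eventually.of_forall fun p => ?_)
    simp only [Pi.mul_apply, Pi.pow_apply, Function.uncurry]
    ring
  · have h3 : ∀ᵐ p ∂((volume.restrict (Ioc 0 t)).prod (volume : Measure ℝ)), p.1 ∈ Ioc 0 t :=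
      Measure.quasiMeasurePreserving_fst.ae (ae_restrict_mem measurableSet_Ioc)
    filter_upwards [h3] with p hp
    rw [Function.uncurry, Real.norm_eq_abs, abs_mul, one_mul]
    refine mul_le_mul_of_nonneg_right ?_ (abs_nonneg _)
    have h1 := sq_le_sq.2 ((hM _ hp.1.le p.2).trans (le_abs_self M))
    rw [abs_of_nonneg (by positivity)]
    nlinarith [sq_nonneg (u p.1 p.2)]

theorem locallyIntegrable_integral_sq (hu : IsEntropySolution u)
    (hM : ∀ t, 0 ≤ t → ∀ x, |u t x| ≤ M) {t : ℝ} (ht : 0 ≤ t) :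
    LocallyIntegrable fun x => ∫ τ in (0 : ℝ)..t, u τ x ^ 2 / 2 := by
  have hm : AEStronglyMeasurable (fun x => ∫ τ in (0 : ℝ)..t, u τ x ^ 2 / 2) volume := by
    have h1 : AEStronglyMeasurable (fun x => ∫ τ in Ioc 0 t, u τ x ^ 2) volume :=
      ((hu.aestronglyMeasurable_prod (t := t)).pow 2).prod_swap.integral_prod_right'
    refine (h1.mul (aestronglyMeasurable_const (b := (1 / 2 : ℝ)))).congr
      (Eventually.of_forall fun x => ?_)
    simp only [Pi.mul_apply]
    rw [intervalIntegral.integral_of_le ht, integral_div]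
    ring
  refine (locallyIntegrable_const (M ^ 2 * t)).mono hm (Eventually.of_forall fun x => ?_)
  have h2 := intervalIntegral.norm_integral_le_of_norm_le_const (a := 0) (b := t)
    (f := fun τ => u τ x ^ 2 / 2) (C := M ^ 2) fun τ hτ => by
      rw [uIoc_of_le ht] at hτ
      have h1 := sq_le_sq.2 ((hM _ hτ.1.le x).trans (le_abs_self M))
      rw [Real.norm_eq_abs, abs_of_nonneg (by positivity)]
      nlinarith [sq_nonneg (u τ x)]
  rw [sub_zero, abs_of_nonneg ht] at h2
  exact h2.trans (le_abs_self _)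

/-- The time integral of the flux is, up to a constant, the change of the spatial primitive. -/
theorem ae_eq_const (hu : IsEntropySolution u) (hM : ∀ t, 0 ≤ t → ∀ x, |u t x| ≤ M) {t : ℝ}
    (ht : 0 ≤ t) : ∃ c, ∀ᵐ x,
      (∫ z in (0 : ℝ)..x, (u t z - u 0 z)) + ∫ τ in (0 : ℝ)..t, u τ x ^ 2 / 2 = c := by
  have hloc : ∀ s, 0 ≤ s → LocallyIntegrable (u s) := fun s hs =>
    (locallyIntegrable_const M).mono (hu.measurable hs).aestronglyMeasurable
      (Eventually.of_forall fun x => (hM s hs x).trans (le_abs_self M))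
  have hd : LocallyIntegrable fun z => u t z - u 0 z := (hloc t ht).sub (hloc 0 le_rfl)
  have hAc : Continuous fun x => ∫ z in (0 : ℝ)..x, (u t z - u 0 z) :=
    intervalIntegral.continuous_primitive
      (fun a b => (hd.integrableOn_isCompact isCompact_uIcc).intervalIntegrable) 0
  have hW := hu.locallyIntegrable_integral_sq hM ht
  refine ae_eq_const_of_integral_mul_deriv_eq_zero (hAc.locallyIntegrable.add hW)
    fun χ hχ hχs => ?_
  have hχc : Continuous (deriv χ) := hχ.continuous_deriv (by simp)
  have hWi : Integrable fun x => (∫ τ in (0 : ℝ)..t, u τ x ^ 2 / 2) * deriv χ x := by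
    simpa [mul_comm, smul_eq_mul] using
      hW.integrable_smul_left_of_hasCompactSupport hχc hχs.deriv
  have hui : ∀ s, 0 ≤ s → Integrable fun x => u s x * χ x := fun s hs => by
    simpa [mul_comm, smul_eq_mul] using
      (hloc s hs).integrable_smul_left_of_hasCompactSupport hχ.continuous hχs
  have h1 := hu.integral_mul_sub hM hχ hχs ht
  have h2 : ∫ τ in (0 : ℝ)..t, ∫ x, u τ x ^ 2 / 2 * deriv χ x =
      ∫ x, (∫ τ in (0 : ℝ)..t, u τ x ^ 2 / 2) * deriv χ x := by
    rw [intervalIntegral_integral_swap]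
    · simp only [intervalIntegral.integral_mul_const]
    · rw [uIoc_of_le ht]
      exact hu.integrable_sq_mul hM (hχc.integrable_of_hasCompactSupport hχs.deriv)
  have h3 := integral_primitive_mul_deriv hd hχ hχs
  simp only [sub_mul] at h3
  rw [integral_sub (hui t ht) (hui 0 le_rfl), h1, h2] at h3
  simp only [add_mul]
  have hAi : Integrable fun x => (∫ z in (0 : ℝ)..x, (u t z - u 0 z)) * deriv χ x :=
    (hAc.mul hχc).integrable_of_hasCompactSupport hχs.deriv.mul_left
  rw [integral_add hAi hWi, h3]
  ring

/-- The potential is `∫_0^x u t`, corrected by a constant which depends on time. The smoothness of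
the initial datum is used only for the Lax condition at time `0`, where it is an equality. -/
theorem exists_isPotential (hu : IsEntropySolution u) (h0 : Continuous (u 0)) :
    ∃ U M, IsPotential u U M := by
  obtain ⟨M, hM⟩ := hu.bounded
  have hM0 : 0 ≤ M := (abs_nonneg _).trans (hM 0 le_rfl 0)
  have hloc : ∀ s, 0 ≤ s → LocallyIntegrable (u s) := fun s hs =>
    (locallyIntegrable_const M).mono (hu.measurable hs).aestronglyMeasurable
      (Eventually.of_forall fun x => (hM s hs x).trans (le_abs_self M))
  have hii : ∀ s, 0 ≤ s → ∀ a b, IntervalIntegrable (u s) volume a b := fun s hs a b =>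
    ((hloc s hs).integrableOn_isCompact isCompact_uIcc).intervalIntegrable
  have hex : ∀ t, ∃ c, 0 ≤ t → ∀ᵐ x,
      (∫ z in (0 : ℝ)..x, (u t z - u 0 z)) + ∫ τ in (0 : ℝ)..t, u τ x ^ 2 / 2 = c := fun t => by
    by_cases ht : 0 ≤ t
    · obtain ⟨c, hc⟩ := hu.ae_eq_const hM ht
      exact ⟨c, fun _ => hc⟩
    · exact ⟨0, fun h' => absurd h' ht⟩
  choose c hc using hex
  have hc0 : c 0 = 0 := by
    obtain ⟨x, hx⟩ := (hc 0 le_rfl).exists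
    simpa using hx.symm
  have hcont : ∀ s, 0 ≤ s → Continuous fun x => ∫ z in (0 : ℝ)..x, u s z := fun s hs =>
    intervalIntegral.continuous_primitive (hii s hs) 0
  refine ⟨fun t x => (∫ z in (0 : ℝ)..x, u t z) - c t, M, hM0, hM, fun t ht => hu.measurable ht,
    fun t ht => (hu.boundedVariation t ht).measurable_and_tendsto.2.1,
    fun t ht => (hu.boundedVariation t ht).measurable_and_tendsto.2.2, fun t ht x => ?_,
    fun t ht x y => ?_, hu.continuousOn_intervalIntegral_sq hM, fun t ht a b => ?_⟩
  · rcases ht.eq_or_lt with rfl | ht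
    · rw [h0.continuousAt.continuousWithinAt.leftLim_eq,
        h0.continuousAt.continuousWithinAt.rightLim_eq]
    · exact hu.lax t ht x
  · rw [sub_sub_sub_cancel_right,
      intervalIntegral.integral_interval_sub_left (hii t ht _ _) (hii t ht _ _)]
  · have hW := hu.locallyIntegrable_integral_sq hM ht
    have hWi : IntervalIntegrable (fun x => ∫ τ in (0 : ℝ)..t, u τ x ^ 2 / 2) volume a b :=
      (hW.integrableOn_isCompact isCompact_uIcc).intervalIntegrable
    have h1 : ∫ x in a..b, ((∫ z in (0 : ℝ)..x, u t z) - c t) =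
        ∫ x in a..b, ((∫ z in (0 : ℝ)..x, u 0 z) - c 0 - ∫ τ in (0 : ℝ)..t, u τ x ^ 2 / 2) := by
      refine intervalIntegral.integral_congr_ae ?_
      filter_upwards [hc t ht] with x hx _
      rw [intervalIntegral.integral_sub (hii t ht _ _) (hii 0 le_rfl _ _)] at hx
      rw [hc0]
      linarith
    have h2 : ∀ a b : ℝ, ∫ τ in (0 : ℝ)..t, ∫ x in Ioc a b, u τ x ^ 2 / 2 =
        ∫ x in Ioc a b, ∫ τ in (0 : ℝ)..t, u τ x ^ 2 / 2 := by
      intro a b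
      refine intervalIntegral_integral_swap ?_
      rw [uIoc_of_le ht]
      have h3 := hu.integrable_sq_mul hM (t := t) (b := (Ioc a b).indicator fun _ => (1 : ℝ))
        ((integrable_indicator_iff measurableSet_Ioc).2 (integrableOn_const (by
          rw [Real.volume_Ioc]; exact ENNReal.ofReal_ne_top)))
      have hle : (volume.restrict (Ioc 0 t)).prod (volume.restrict (Ioc a b)) ≤
          (volume.restrict (Ioc 0 t)).prod (volume : Measure ℝ) := by
        have h4 := Measure.prod_restrict (μ := volume.restrict (Ioc 0 t))
          (ν := (volume : Measure ℝ)) univ (Ioc a b)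
        rw [Measure.restrict_univ] at h4
        exact h4.le.trans Measure.restrict_le_self
      have h4 := h3.mono_measure hle
      refine h4.congr ?_
      have h5 : ∀ᵐ p ∂((volume.restrict (Ioc 0 t)).prod (volume.restrict (Ioc a b))),
          p.2 ∈ Ioc a b :=
        Measure.quasiMeasurePreserving_snd.ae (ae_restrict_mem measurableSet_Ioc)
      filter_upwards [h5] with p hp
      rw [Function.uncurry, Function.uncurry, indicator_of_mem hp, mul_one]
    have h2i : ∀ a b : ℝ,
        IntervalIntegrable (fun τ => ∫ x in Ioc a b, u τ x ^ 2 / 2) volume 0 t := by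
      intro a b
      have h3 : ContinuousOn (fun τ => ∫ x in Ioc a b, u τ x ^ 2) (Icc 0 t) := by
        rcases le_total a b with hab | hab
        · refine ((hu.continuousOn_intervalIntegral_sq hM a b).mono Icc_subset_Ici_self).congr
            fun τ _ => ?_
          simp only
          rw [intervalIntegral.integral_of_le hab]
        · simp only [Ioc_eq_empty (not_lt.2 hab), setIntegral_empty]
          exact continuousOn_const
      have h4 := (h3.div_const 2)
      rw [← uIcc_of_le ht] at h4
      simp only [integral_div]
      exact h4.intervalIntegrable
    have h6 : ∫ x in a..b, ∫ τ in (0 : ℝ)..t, u τ x ^ 2 / 2 =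
        1 / 2 * ∫ τ in (0 : ℝ)..t, ∫ x in a..b, u τ x ^ 2 := by
      rw [intervalIntegral, ← h2, ← h2, ← intervalIntegral.integral_sub (h2i a b) (h2i b a),
        ← intervalIntegral.integral_const_mul]
      congr 1
      ext τ
      rw [intervalIntegral, integral_div, integral_div]
      ring
    have hci : IntervalIntegrable (fun x => (∫ z in (0 : ℝ)..x, u 0 z) - c 0) volume a b :=
      ((hcont 0 le_rfl).sub continuous_const).intervalIntegrable _ _
    rw [h1, intervalIntegral.integral_sub hci hWi, h6]

end IsEntropySolution

theorem proposition3p2 (u : ℝ → ℝ → ℝ) (hu : IsEntropySolution u) (hsmooth : ContDiff ℝ ∞ (u 0))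
    (tf xf t₀ : ℝ) (htf : 0 < tf) (hshock : IsShock u tf xf)
    (ht₀ : 0 ≤ t₀) (ht₀' : t₀ < formationTime u tf xf) :
    (∃ (P : Measure ℝ) (X : ℝ → ℝ → ℝ),
      IsProbabilityMeasure P ∧ IsGeometricProcess u tf xf t₀ P X) ∧
    ∀ (Ω : Type*) (_ : MeasurableSpace Ω) (P : Measure Ω) (_ : IsProbabilityMeasure P)
      (X : ℝ → Ω → ℝ), IsGeometricProcess u tf xf t₀ P X →
      (∀ t ∈ Icc 0 tf, Measurable (velocity u X t) ∧ Integrable (velocity u X t) P) ∧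
      ∀ t ∈ Icc 0 tf, ∀ s ∈ Icc 0 tf, t ≤ s →
        P[velocity u X t | MeasurableSpace.comap (velocity u X s) inferInstance]
          =ᵐ[P] velocity u X s := by
  obtain ⟨U, M, h⟩ := hu.exists_isPotential hsmooth.continuous
  have ht₀tf : t₀ < tf := ht₀'.trans_le (h.formationTime_le htf hshock)
  refine ⟨h.exists_geometric_process hshock ht₀ ht₀tf, fun Ω _ P _ X hX => ⟨fun t ht =>
    ⟨h.measurable_velocity hX ht, h.integrable_velocity hX ht⟩, fun t ht s hs hts => ?_⟩⟩
  exact h.condExp_velocity hX ht₀ ht₀' ht₀tf.le ht hs hts
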